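/- Let $R$ be an irreducible, reduced, crystallographic root system spanning a real Euclidean space $V$, with coroots $\alpha^\vee=2\alpha/\langle\alpha,\alpha\rangle$, positive roots $R^+$ and simple roots $\alpha_1,\dots,\alpha_n$. Let $P=\{\lambda\in V\mid \langle\lambda,\alpha^\vee\rangle\in\mathbb Z\ \forall\alpha\in R\}$ be the weight lattice, $A=\{x\in V\mid 0<\langle x,\alpha^\vee\rangle<1\ \forall\alpha\in R^+\}$ the Weyl alcove, and, for $\alpha\in R^+$ and $k\in\mathbb Z$, let $s_{\alpha,k}$ be the orthogonal reflection in the hyperplane $V_{\alpha,k}=\{x\in V\mid\langle x,\alpha^\vee\rangle=k\}$. Let $W$ be the extended affine Weyl group, i.e. the group of affine transformations of $V$ generated by the reflections $s_{\alpha,0}$ $(\alpha\in R^+)$ and the translations $t_\lambda$ $(\lambda\in P)$; let $\ell(w)$ be the number of hyperplanes $V_{\alpha,k}$ separating $A$ and $wA$, and $\Omega=\{u\in W\mid uA=A\}$. Let $\alpha_0\in R^+$ be the root for which $\alpha_0^\vee$ is the highest root of $R^\vee$, and put $V_0=V_{\alpha_0,1}$, $s_0=s_{\alpha_0,1}$,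 and $V_j=V_{\alpha_j,0}$, $s_j=s_{\alpha_j,0}$ for $1\le j\le n$. Let $q:W\to\mathbb R\setminus\{0\}$ be length multiplicative: $q_{ww'}=q_wq_{w'}$ whenever $\ell(ww')=\ell(w)+\ell(w')$, and $q_w=1$ whenever $\ell(w)=0$. Write $q_j=q_{s_j}$. The (extended) affine Hecke algebra $\mathcal H$ of $W$ and $q$ is the unital associative complex algebra generated by elements $T_w$ $(w\in W)$, with $T_1=1$, subject to the relations $T_{ww'}=T_wT_{w'}$ whenever $\ell(ww')=\ell(w)+\ell(w')$, and $(T_j-q_j)(T_j+q_j^{-1})=0$ for $j=0,\dots,n$, where $T_j=T_{s_j}$. Let $C(P)$ be the space of all functions $f:P\to\mathbb C$, with $W$ acting by $(wf)(\lambda)=f(w^{-1}\lambda)$. For $j=0,\dots,n$ define the operator $\hat T_j=q_j+\chi_j(s_j-1)$ on $C(P)$, where $q_j$ and $\chi_j$ act by multiplication and $$\chi_j(\lambda)=\begin{cases}q_j&\text{if }V_j\text{ separates }\lambda\text{ and }A,\\ 1&\text{if }\lambda\in V_j,\\ q_j^{-1}&\text{otherwise.}\end{cases}$$ **Theorem (Difference-Reflection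 Representation).** The assignment $T_j\mapsto\hat T_j$ $(j=0,\dots,n)$ and $T_u\mapsto u$ $(u\in\Omega)$ extends uniquely to a representation of $\mathcal H$ on $C(P)$; that is, there is exactly one unital $\mathbb C$-algebra homomorphism $\hat T:\mathcal H\to\mathrm{End}_{\mathbb C}(C(P))$ with $\hat T(T_j)=\hat T_j$ for $j=0,\dots,n$ and $\hat T(T_u)=u$ for all $u\in\Omega$. -/

import Mathlib

noncomputable section

open RootPairing

namespace AffineHecke

section Geometry

variable {ι V V' : Type*} [AddCommGroup V] [Module ℝ V] [AddCommGroup V'] [Module ℝ V']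
  (Φ : RootPairing ι ℝ V V')

/-- The weight lattice `P = {λ ∈ V | ⟨λ, α^∨⟩ ∈ ℤ for all roots α}`. -/
def weightLattice : AddSubgroup V where
  carrier := {x | ∀ i, ∃ m : ℤ, Φ.coroot' i x = m}
  zero_mem' i := ⟨0, by simp⟩
  add_mem' {x y} hx hy i := by
    obtain ⟨m, hm⟩ := hx i
    obtain ⟨k, hk⟩ := hy i
    exact ⟨m + k, by rw [map_add, hm, hk]; push_cast; rfl⟩
  neg_mem' {x} hx i := by
    obtain ⟨m, hm⟩ := hx i
    exact ⟨-m, by rw [map_neg, hm]; push_cast; rfl⟩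

/-- The hyperplane `V_{α,k} = {x | ⟨x, α^∨⟩ = k}`. -/
def hyperplane (i : ι) (k : ℤ) : Set V := {x | Φ.coroot' i x = k}

/-- The hyperplane `V_{α,k}` separates the sets `S` and `T`: these lie in distinct connected
components, that is in distinct open half-spaces, of the complement of `V_{α,k}`. -/
def Separates (i : ι) (k : ℤ) (S T : Set V) : Prop :=
  ((∀ x ∈ S, Φ.coroot' i x < k) ∧ ∀ y ∈ T, (k : ℝ) < Φ.coroot' i y) ∨
    ((∀ x ∈ S, (k : ℝ) < Φ.coroot' i x) ∧ ∀ y ∈ T, Φ.coroot' i y < k)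

/-- The translation `t_v : x ↦ x + v`. -/
def translation (v : V) : V ≃ᵃ[ℝ] V := AffineEquiv.constVAdd ℝ V v

/-- The reflection `s_{α,k} : x ↦ x - (⟨x, α^∨⟩ - k) α` across the hyperplane `V_{α,k}`. -/
def affineReflection (i : ι) (k : ℤ) : V ≃ᵃ[ℝ] V :=
  translation ((k : ℝ) • Φ.root i) * (Φ.reflection i).toAffineEquiv

lemma affineReflection_apply (i : ι) (k : ℤ) (x : V) :
    affineReflection Φ i k x = x - (Φ.coroot' i x - k) • Φ.root i := by
  simp only [affineReflection, translation, AffineEquiv.coe_mul, Function.comp_apply,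
    LinearEquiv.coe_toAffineEquiv, AffineEquiv.constVAdd_apply, vadd_eq_add,
    RootPairing.reflection_apply]
  module

/-- The extended affine Weyl group `W`, generated by the reflections `s_{α,0}` and the translations
`t_λ` with `λ ∈ P`. -/
def affineWeylGroup : Subgroup (V ≃ᵃ[ℝ] V) :=
  Subgroup.closure
    (Set.range (fun i ↦ affineReflection Φ i 0) ∪ translation '' (weightLattice Φ : Set V))

lemma root_mem_weightLattice [Φ.IsCrystallographic] (i : ι) : Φ.root i ∈ weightLattice Φ := by
  intro j
  obtain ⟨m, hm⟩ := Φ.exists_value (S := ℤ) i j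
  exact ⟨m, by rw [Φ.root_coroot'_eq_pairing, ← hm]; simp⟩

lemma affineReflection_mem [Φ.IsCrystallographic] (i : ι) (k : ℤ) :
    affineReflection Φ i k ∈ affineWeylGroup Φ := by
  have h : affineReflection Φ i k
      = translation ((k : ℝ) • Φ.root i) * affineReflection Φ i 0 := by
    ext x
    simp only [affineReflection_apply, translation, AffineEquiv.coe_mul, Function.comp_apply,
      AffineEquiv.constVAdd_apply, vadd_eq_add, Int.cast_zero]
    module
  rw [h]
  refine mul_mem (Subgroup.subset_closure (Or.inr ⟨_, ?_, rfl⟩))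
    (Subgroup.subset_closure (Or.inl ⟨i, rfl⟩))
  rw [Int.cast_smul_eq_zsmul]
  exact zsmul_mem (root_mem_weightLattice Φ i) k

/-- The action of `W` on `V` preserves the weight lattice. -/
lemma apply_mem_weightLattice [Φ.IsCrystallographic] {w : V ≃ᵃ[ℝ] V}
    (hw : w ∈ affineWeylGroup Φ) {x : V} (hx : x ∈ weightLattice Φ) : w x ∈ weightLattice Φ := by
  have hrefl : ∀ i, ∀ y ∈ weightLattice Φ, affineReflection Φ i 0 y ∈ weightLattice Φ := by
    intro i y hy
    obtain ⟨m, hm⟩ := hy i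
    rw [affineReflection_apply, hm, Int.cast_zero, sub_zero, Int.cast_smul_eq_zsmul]
    exact sub_mem hy (zsmul_mem (root_mem_weightLattice Φ i) m)
  suffices h : ∀ y ∈ weightLattice Φ, w y ∈ weightLattice Φ ∧ w⁻¹ y ∈ weightLattice Φ from
    (h x hx).1
  clear hx x
  induction hw using Subgroup.closure_induction with
  | mem g hg =>
    intro y hy
    rcases hg with ⟨i, rfl⟩ | ⟨v, hv, rfl⟩
    · refine ⟨hrefl i y hy, ?_⟩
      have hinv : (affineReflection Φ i 0)⁻¹ = affineReflection Φ i 0 := by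
        rw [inv_eq_iff_mul_eq_one]
        ext z
        simp only [AffineEquiv.coe_mul, Function.comp_apply, affineReflection_apply, map_sub,
          map_smul, Φ.root_coroot'_eq_pairing, Φ.pairing_same, AffineEquiv.coe_one, id_eq,
          smul_eq_mul, Int.cast_zero]
        module
      simp only [hinv]
      exact hrefl i y hy
    · refine ⟨add_mem hv hy, ?_⟩
      have : (translation v)⁻¹ y = -v + y := by
        rw [AffineEquiv.inv_def, translation, AffineEquiv.constVAdd_symm]
        rfl
      rw [this]
      exact add_mem (neg_mem hv) hy
  | one => intro y hy; exact ⟨hy, by simpa using hy⟩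
  | mul a c _ _ ha hc =>
    intro y hy
    refine ⟨(ha _ (hc y hy).1).1, ?_⟩
    rw [mul_inv_rev]
    exact (hc _ (ha y hy).2).2
  | inv a _ ha => intro y hy; exact ⟨(ha y hy).2, by rw [inv_inv]; exact (ha y hy).1⟩

/-- The action `(w f)(λ) = f(w⁻¹ λ)` of `W` on the space `C(P)` of functions `P → ℂ`. -/
def weylAction [Φ.IsCrystallographic] (w : affineWeylGroup Φ) :
    Module.End ℂ (weightLattice Φ → ℂ) where
  toFun f x := f ⟨(w⁻¹ : affineWeylGroup Φ).1 x.1, apply_mem_weightLattice Φ (w⁻¹).2 x.2⟩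
  map_add' _ _ := rfl
  map_smul' _ _ := rfl

end Geometry

section Hecke

variable {ι V V' : Type*} [Finite ι] [AddCommGroup V] [Module ℝ V] [AddCommGroup V'] [Module ℝ V']
  {Φ : RootPairing ι ℝ V V'} [Φ.IsCrystallographic] [Φ.IsReduced] (b : Φ.Base)

/-- The (fundamental) alcove `A = {x | 0 < ⟨x, α^∨⟩ < 1 for all α ∈ R⁺}`. -/
def alcove : Set V := {x | ∀ i, b.IsPos i → 0 < Φ.coroot' i x ∧ Φ.coroot' i x < 1}

/-- The length `ℓ(w)`: the number of hyperplanes `V_{α,k}`, `α ∈ R⁺`, `k ∈ ℤ`, separating `A` and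
`wA` (for a reduced root system these hyperplanes are pairwise distinct). -/
def length (w : affineWeylGroup Φ) : ℕ :=
  Set.ncard {p : ι × ℤ | b.IsPos p.1 ∧ Separates Φ p.1 p.2 (alcove b) (w.1 '' alcove b)}

/-- The subgroup `Ω = {u ∈ W | uA = A}`. -/
def Omega : Subgroup (affineWeylGroup Φ) where
  carrier := {u | u.1 '' alcove b = alcove b}
  one_mem' := Set.image_id _
  mul_mem' {u v} hu hv := by
    change (u.1 * v.1 : V ≃ᵃ[ℝ] V) '' _ = _
    rw [AffineEquiv.coe_mul, Set.image_comp, Set.mem_ofPred_eq.mp hv, Set.mem_ofPred_eq.mp hu]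
  inv_mem' {u} hu := by
    change (u.1⁻¹ : V ≃ᵃ[ℝ] V) '' _ = _
    conv_lhs => rw [← Set.mem_ofPred_eq.mp hu]
    rw [← Set.image_comp, ← AffineEquiv.coe_mul, inv_mul_cancel]
    exact Set.image_id _

/-- The coroot with index `i₀` is the highest root of the dual root system `R^∨` with respect to
the base of simple coroots. -/
def IsHighestCoroot (i₀ : ι) : Prop :=
  ∀ i, Φ.coroot i₀ - Φ.coroot i ∈ AddSubmonoid.closure (Φ.coroot '' b.support)

/-- The pairs `(α, k)` with `V_{α,k}` the wall `V_j` of `A`: `(α₀, 1)` for `j = 0` (represented by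
`none`) and `(α_j, 0)` for the simple roots `α_j`. -/
def wall (i₀ : ι) : Option b.support → ι × ℤ
  | none => (i₀, 1)
  | some j => (j, 0)

/-- The reflections `s_0 = s_{α₀,1}` and `s_j = s_{α_j,0}`, as elements of `W`. -/
def simpleReflection (i₀ : ι) (j : Option b.support) : affineWeylGroup Φ :=
  ⟨affineReflection Φ (wall b i₀ j).1 (wall b i₀ j).2, affineReflection_mem Φ _ _⟩

/-- Length multiplicative functions `q : W → ℝ ∖ {0}`. -/
structure IsLengthMultiplicative (q : affineWeylGroup Φ → ℝ) : Prop where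
  ne_zero : ∀ w, q w ≠ 0
  map_mul : ∀ w w', length b (w * w') = length b w + length b w' → q (w * w') = q w * q w'
  map_length_zero : ∀ w, length b w = 0 → q w = 1

/-- The defining relations of the affine Hecke algebra between the generators `T_w`, `w ∈ W`. -/
inductive HeckeRel (i₀ : ι) (q : affineWeylGroup Φ → ℝ) :
    FreeAlgebra ℂ (affineWeylGroup Φ) → FreeAlgebra ℂ (affineWeylGroup Φ) → Prop
  | one : HeckeRel i₀ q (FreeAlgebra.ι ℂ 1) 1
  | quadratic (j : Option b.support) : HeckeRel i₀ q
      ((FreeAlgebra.ι ℂ (simpleReflection b i₀ j)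
          - algebraMap ℂ _ (q (simpleReflection b i₀ j) : ℂ)) *
        (FreeAlgebra.ι ℂ (simpleReflection b i₀ j)
          + algebraMap ℂ _ ((q (simpleReflection b i₀ j) : ℂ)⁻¹))) 0
  | braid (w w' : affineWeylGroup Φ) (h : length b (w * w') = length b w + length b w') :
      HeckeRel i₀ q (FreeAlgebra.ι ℂ (w * w')) (FreeAlgebra.ι ℂ w * FreeAlgebra.ι ℂ w')

/-- The (extended) affine Hecke algebra `H` associated with `W` and `q`. -/
abbrev HeckeAlgebra (i₀ : ι) (q : affineWeylGroup Φ → ℝ) : Type _ := RingQuot (HeckeRel b i₀ q)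

/-- The element `T_w` of the affine Hecke algebra. -/
def heckeT (i₀ : ι) (q : affineWeylGroup Φ → ℝ) (w : affineWeylGroup Φ) : HeckeAlgebra b i₀ q :=
  RingQuot.mkAlgHom ℂ (HeckeRel b i₀ q) (FreeAlgebra.ι ℂ w)

open Classical in
/-- The function `χ_j` on `P`: `q_j` at `λ` if `V_j` separates `λ` and `A`, `1` if `λ ∈ V_j`, and
`q_j⁻¹` otherwise. -/
def chi (i₀ : ι) (q : affineWeylGroup Φ → ℝ) (j : Option b.support) (x : weightLattice Φ) : ℂ :=
  if Separates Φ (wall b i₀ j).1 (wall b i₀ j).2 {x.1} (alcove b) then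
    (q (simpleReflection b i₀ j) : ℂ)
  else if x.1 ∈ hyperplane Φ (wall b i₀ j).1 (wall b i₀ j).2 then 1
  else (q (simpleReflection b i₀ j) : ℂ)⁻¹

/-- The difference-reflection operator `T̂_j = q_j + χ_j (s_j - 1)` on `C(P)`, where `q_j` and `χ_j`
act by multiplication. -/
def diffReflection (i₀ : ι) (q : affineWeylGroup Φ → ℝ) (j : Option b.support) :
    Module.End ℂ (weightLattice Φ → ℂ) :=
  (q (simpleReflection b i₀ j) : ℂ) • 1 +
    LinearMap.mulLeft ℂ (chi b i₀ q j) * (weylAction Φ (simpleReflection b i₀ j) - 1)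

end Hecke

end AffineHecke

end

/-! ### Abstract length functions -/

open RootPairing

/-! The operators $\hat T_j$ are shadows of the regular representation of $\mathcal H$. For a weight
$y$ in the closed alcove and a function $f$ on $P$, put $F(w)=f(wy)$. If $wy\notin V_j$, then $wy$
and $wA$ lie on the same side of $V_j$, so $\chi_j(wy)$ depends only on whether $s_j$ is a left
descent of $w$; if $wy\in V_j$, the difference $f(s_jwy)-f(wy)$ vanishes and the value of $\chi_j$
is irrelevant. Hence $f\mapsto F$ intertwines $\hat T_j$ with an operator on functions on $W$
(`orbitMap_diffReflection`). Every weight is conjugate to one in the closed alcove, so these maps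
are jointly injective (`ext_of_orbitMap`), and all relations may be checked on $W$.

On $W$ the relations come from a commuting right action, with no comparison of reduced words. Left
and right operators commute by the exchange condition (`leftOp_rightOp`), and an operator commuting
with the right action is determined by its values at $1$ (`eq_zero_of_commute`). The operator that
should be $T_w^{-1}$ has the one-term value $q_w^{-1}f(w)$ at $1$, so it depends on $w$ alone, and
$T_{vw}=T_vT_w$ follows for length-additive products (`exists_regular_representation`).

The length properties used (`isLengthSystem`) are geometric: $W$ permutes the affine roots, and only
$V_j$ separates $A$ from $s_jA$, because $V_j$ contains a point of the closed alcove lying on no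
other root hyperplane. Uniqueness holds because every $w$ is a length-additive product of simple
reflections and an element of $\Omega$. -/

/-- The properties of the length function of an extended affine Weyl group, with simple reflections
`s j`, that enter into the construction of its regular Hecke module. -/
structure IsLengthSystem {G J : Type*} [Group G] (s : J → G) (ℓ : G → ℕ) : Prop where
  sq : ∀ j, s j * s j = 1
  one : ℓ 1 = 0
  inv : ∀ g, ℓ g⁻¹ = ℓ g
  mul_of_length_zero : ∀ g u, ℓ u = 0 → ℓ (g * u) = ℓ g
  step : ∀ j g, ℓ (s j * g) = ℓ g + 1 ∨ ℓ g = ℓ (s j * g) + 1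
  descent : ∀ g, ℓ g ≠ 0 → ∃ j, ℓ (s j * g) < ℓ g
  exchange : ∀ j t g, ℓ (s j * g) < ℓ g → ℓ (g * s t) < ℓ (s j * g * s t) → s j * g = g * s t

namespace IsLengthSystem

variable {G J : Type*} [Group G] {s : J → G} {ℓ : G → ℕ}

lemma mul_self_mul (h : IsLengthSystem s ℓ) (j : J) (g : G) : s j * (s j * g) = g := by
  rw [← mul_assoc, h.sq, one_mul]

lemma mul_mul_self (h : IsLengthSystem s ℓ) (j : J) (g : G) : g * s j * s j = g := by
  rw [mul_assoc, h.sq, mul_one]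

lemma inv_simple (h : IsLengthSystem s ℓ) (j : J) : (s j)⁻¹ = s j :=
  inv_eq_of_mul_eq_one_left (h.sq j)

lemma length_zero_mul (h : IsLengthSystem s ℓ) (u g : G) (hu : ℓ u = 0) : ℓ (u * g) = ℓ g := by
  rw [← h.inv, mul_inv_rev, h.mul_of_length_zero _ _ ((h.inv u).trans hu), h.inv]

/-- If the descent status of $s_j$ changes between $g$ and $gs_t$, then one of the two has the
descent and the other lacks it; `exchange` at the one with the descent yields $s_jg=gs_t$. -/
lemma exchange' (h : IsLengthSystem s ℓ) (j t : J) (g : G) :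
    s j * g = g * s t ∨
      (ℓ (s j * g) < ℓ g ↔ ℓ (s j * (g * s t)) < ℓ (g * s t)) := by
  by_contra! hc
  obtain ⟨h1, h2⟩ := hc
  have e1 := h.step j g
  have e2 := h.step j (g * s t)
  have e3 := h.exchange j t g
  have e4 := h.exchange j t (g * s t)
  rw [← mul_assoc, h.mul_mul_self, h.mul_mul_self] at e4
  rw [← mul_assoc] at h2 e2
  rcases h2 with ⟨a, c⟩ | ⟨a, c⟩
  · exact h1 (e3 a (by omega))
  · apply h1
    rw [← h.mul_mul_self t (s j * g), e4 c (by omega)]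

lemma length_simple_mul (h : IsLengthSystem s ℓ) {j : J} {g : G} (hg : ℓ g < ℓ (s j * g)) :
    ℓ (s j * g) = ℓ g + 1 := by
  have := h.step j g
  omega

lemma length_simple (h : IsLengthSystem s ℓ) (j : J) : ℓ (s j) = 1 := by
  have := h.step j 1
  rw [mul_one, h.one] at this
  omega

/-- Induction over reduced decompositions. -/
lemma induction (h : IsLengthSystem s ℓ) {p : G → Prop} (zero : ∀ u, ℓ u = 0 → p u)
    (mul : ∀ j g, ℓ (s j * g) = ℓ g + 1 → p g → p (s j * g)) (g : G) : p g := by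
  induction hn : ℓ g using Nat.strong_induction_on generalizing g with
  | _ n ih =>
    subst hn
    by_cases hg : ℓ g = 0
    · exact zero g hg
    · obtain ⟨j, hj⟩ := h.descent g hg
      have := mul j (s j * g) (by rw [h.mul_self_mul]; have := h.step j g; omega)
        (ih _ hj _ rfl)
      rwa [h.mul_self_mul] at this

lemma length_mul_le (h : IsLengthSystem s ℓ) (v w : G) : ℓ (v * w) ≤ ℓ v + ℓ w := by
  induction v using h.induction with
  | zero u hu => rw [h.length_zero_mul u w hu]; omega
  | mul j g hg ih =>
    have := h.step j (g * w)
    rw [← mul_assoc] at this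
    omega

end IsLengthSystem

/-! ### The regular representation on functions on the group -/

namespace AffineHecke

section Regular

variable {G J : Type*} [Group G] (s : J → G) (ℓ : G → ℕ) (Q : G → ℂ)

/-- The function `q_j^{±1}` on the group, with `q_j` at the elements having `s_j` as a left
descent. -/
noncomputable def regularChi (j : J) (g : G) : ℂ :=
  if ℓ (s j * g) < ℓ g then Q (s j) else (Q (s j))⁻¹

/-- The difference-reflection operator on functions on the group acting from the left. -/
noncomputable def leftOp (j : J) : Module.End ℂ (G → ℂ) where
  toFun f g := Q (s j) * f g + regularChi s ℓ Q j g * (f (s j * g) - f g)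
  map_add' f f' := by ext g; simp only [Pi.add_apply]; ring
  map_smul' c f := by ext g; simp only [Pi.smul_apply, smul_eq_mul, RingHom.id_apply]; ring

/-- The difference-reflection operator on functions on the group acting from the right. -/
noncomputable def rightOp (j : J) : Module.End ℂ (G → ℂ) where
  toFun f g := Q (s j) * f g + regularChi s ℓ Q j g⁻¹ * (f (g * s j) - f g)
  map_add' f f' := by ext g; simp only [Pi.add_apply]; ring
  map_smul' c f := by ext g; simp only [Pi.smul_apply, smul_eq_mul, RingHom.id_apply]; ring

/-- `(f ↦ f (u * ·))`. -/
def leftTranslate (u : G) : Module.End ℂ (G → ℂ) where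
  toFun f g := f (u * g)
  map_add' _ _ := rfl
  map_smul' _ _ := rfl

/-- `(f ↦ f (· * u))`. -/
def rightTranslate (u : G) : Module.End ℂ (G → ℂ) where
  toFun f g := f (g * u)
  map_add' _ _ := rfl
  map_smul' _ _ := rfl

/-- The operator `X` is the inverse of the action of `T_w` on functions on the group: it commutes
with the right action and evaluates at `1` as `f ↦ q_w⁻¹ f(w)`. -/
structure IsInverseHeckeOp (w : G) (X : Module.End ℂ (G → ℂ)) : Prop where
  comm_right : ∀ t f, X (rightOp s ℓ Q t f) = rightOp s ℓ Q t (X f)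
  comm_translate : ∀ u, ℓ u = 0 → ∀ f, X (rightTranslate u f) = rightTranslate u (X f)
  apply_one : ∀ f, X f 1 = (Q w)⁻¹ * f w

variable {s ℓ Q}

lemma leftOp_apply (j : J) (f : G → ℂ) (g : G) :
    leftOp s ℓ Q j f g = Q (s j) * f g + regularChi s ℓ Q j g * (f (s j * g) - f g) := rfl

lemma rightOp_apply (j : J) (f : G → ℂ) (g : G) :
    rightOp s ℓ Q j f g = Q (s j) * f g + regularChi s ℓ Q j g⁻¹ * (f (g * s j) - f g) := rfl

lemma regularChi_ne_zero (hQ : ∀ w, Q w ≠ 0) (j : J) (g : G) : regularChi s ℓ Q j g ≠ 0 := by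
  rw [regularChi]; split_ifs <;> simp [hQ]

/-- Exactly one of $g$ and $s_jg$ has $s_j$ as a left descent. -/
lemma regularChi_mul_regularChi (h : IsLengthSystem s ℓ) (hQ : ∀ w, Q w ≠ 0) (j : J) (g : G) :
    regularChi s ℓ Q j g * regularChi s ℓ Q j (s j * g) = 1 := by
  have := h.step j g
  rw [regularChi, regularChi, h.mul_self_mul]
  split_ifs <;> first | omega | simp [hQ]

lemma regularChi_root (hQ : ∀ w, Q w ≠ 0) (j : J) (g : G) :
    regularChi s ℓ Q j g * (Q (s j) + (Q (s j))⁻¹) = 1 + regularChi s ℓ Q j g ^ 2 := by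
  have := hQ (s j)
  rw [regularChi]
  split_ifs <;> field_simp
  ring

/-- The operator mixes only the values at $g$ and $s_jg$. The quadratic relation is thus a
two-by-two computation, which uses that the two coefficients are inverse to each other and are roots
of $X^2-(q_j+q_j^{-1})X+1$. -/
lemma leftOp_leftOp (h : IsLengthSystem s ℓ) (hQ : ∀ w, Q w ≠ 0) (j : J) (f : G → ℂ) :
    leftOp s ℓ Q j (leftOp s ℓ Q j f) = (Q (s j) - (Q (s j))⁻¹) • leftOp s ℓ Q j f + f := by
  ext g
  have h1 := regularChi_mul_regularChi h hQ j g
  have h2 := regularChi_root (s := s) (ℓ := ℓ) hQ j g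
  have h3 := mul_inv_cancel₀ (hQ (s j))
  simp only [Pi.add_apply, Pi.smul_apply, smul_eq_mul, leftOp_apply, h.mul_self_mul]
  linear_combination (f g - f (s j * g)) * h1 + (f (s j * g) - f g) * h2 + f g * h3

/-- If $s_jg\ne gs_t$, multiplication on one side leaves the descents on the other side unchanged,
so the coefficients pass through. If $s_jg=gs_t$, then $q_j=q_t$ and the left and right operators
agree at both $g$ and $s_jg$. -/
lemma leftOp_rightOp (h : IsLengthSystem s ℓ)
    (hmul : ∀ v w, ℓ (v * w) = ℓ v + ℓ w → Q (v * w) = Q v * Q w) (hQ : ∀ w, Q w ≠ 0)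
    (j t : J) (f : G → ℂ) :
    leftOp s ℓ Q j (rightOp s ℓ Q t f) = rightOp s ℓ Q t (leftOp s ℓ Q j f) := by
  -- The value of $q$ at the longer element $s_jg=gs_t$ factors in two ways.
  have key : ∀ g, s j * g = g * s t → ℓ g < ℓ (s j * g) → Q (s j) = Q (s t) := by
    intro g hg hlt
    have h1 := h.length_simple_mul hlt
    have h2 := hmul (s j) g (by rw [h1, h.length_simple, add_comm])
    have h3 := hmul g (s t) (by rw [← hg, h1, h.length_simple])
    rw [hg, h3, mul_comm] at h2
    exact (mul_right_cancel₀ (hQ g) h2).symm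
  have inv_mul : ∀ g, s t * g⁻¹ = (g * s t)⁻¹ := by
    intro g; rw [mul_inv_rev, h.inv_simple]
  have inv_mul' : ∀ g, g⁻¹ * s j = (s j * g)⁻¹ := by
    intro g; rw [mul_inv_rev, h.inv_simple]
  ext g
  by_cases hg : s j * g = g * s t
  · have hq : Q (s j) = Q (s t) := by
      rcases lt_or_ge (ℓ g) (ℓ (s j * g)) with hl | hl
      · exact key g hg hl
      · refine key (s j * g) ?_ ?_
        · rw [h.mul_self_mul, hg, h.mul_mul_self]
        · rw [h.mul_self_mul]; have := h.step j g; omega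
    have hχ : ∀ g, s j * g = g * s t → regularChi s ℓ Q t g⁻¹ = regularChi s ℓ Q j g := by
      intro g hg
      rw [regularChi, regularChi, inv_mul, h.inv, h.inv, hg, hq]
    have hL : ∀ (f : G → ℂ) g, s j * g = g * s t → rightOp s ℓ Q t f g = leftOp s ℓ Q j f g := by
      intro f g hg
      rw [leftOp_apply, rightOp_apply, hχ g hg, hg, hq]
    have hg' : s j * (s j * g) = s j * g * s t := by
      rw [h.mul_self_mul, hg, h.mul_mul_self]
    rw [hL _ g hg, leftOp_apply, leftOp_apply, hL _ g hg, hL _ _ hg']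
  · have hg' : s j * (s j * g) ≠ s j * g * s t := by
      intro hc
      rw [mul_assoc] at hc
      exact hg (mul_left_cancel hc)
    have hgi : s t * g⁻¹ ≠ g⁻¹ * s j := by
      rw [inv_mul, inv_mul', ne_eq, inv_inj]
      exact fun hc ↦ hg hc.symm
    have e1 : regularChi s ℓ Q j (g * s t) = regularChi s ℓ Q j g := by
      simp only [regularChi, (h.exchange' j t g).resolve_left hg]
    have e2 : regularChi s ℓ Q t (s j * g)⁻¹ = regularChi s ℓ Q t g⁻¹ := by
      simp only [regularChi, ← inv_mul', (h.exchange' t j g⁻¹).resolve_left hgi]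
    simp only [leftOp_apply, rightOp_apply, e1, e2, mul_assoc]
    ring

lemma leftOp_rightTranslate (h : IsLengthSystem s ℓ) (j : J) (u : G) (hu : ℓ u = 0) (f : G → ℂ) :
    leftOp s ℓ Q j (rightTranslate u f) = rightTranslate u (leftOp s ℓ Q j f) := by
  ext g
  have : regularChi s ℓ Q j (g * u) = regularChi s ℓ Q j g := by
    rw [regularChi, regularChi, ← mul_assoc, h.mul_of_length_zero _ _ hu,
      h.mul_of_length_zero _ _ hu]
  simp only [rightTranslate, LinearMap.coe_mk, AddHom.coe_mk, leftOp_apply, this, mul_assoc]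

lemma leftTranslate_rightOp (h : IsLengthSystem s ℓ) (t : J) (u : G) (hu : ℓ u = 0) (f : G → ℂ) :
    leftTranslate u (rightOp s ℓ Q t f) = rightOp s ℓ Q t (leftTranslate u f) := by
  ext g
  have : regularChi s ℓ Q t (u * g)⁻¹ = regularChi s ℓ Q t g⁻¹ := by
    have hu' : ℓ u⁻¹ = 0 := (h.inv u).trans hu
    rw [regularChi, regularChi, mul_inv_rev, ← mul_assoc, h.mul_of_length_zero _ _ hu',
      h.mul_of_length_zero _ _ hu']
  simp only [leftTranslate, LinearMap.coe_mk, AddHom.coe_mk, rightOp_apply, this, mul_assoc]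

/-- The right action moves any point to $1$: a length-zero element by a right translation, any other
by induction along a right descent. -/
lemma eq_zero_of_commute (h : IsLengthSystem s ℓ) (hQ : ∀ w, Q w ≠ 0)
    {Z : Module.End ℂ (G → ℂ)}
    (comm_right : ∀ t f, Z (rightOp s ℓ Q t f) = rightOp s ℓ Q t (Z f))
    (comm_translate : ∀ u, ℓ u = 0 → ∀ f, Z (rightTranslate u f) = rightTranslate u (Z f))
    (apply_one : ∀ f, Z f 1 = 0) : Z = 0 := by
  have main : ∀ n g, ℓ g = n → ∀ f, Z f g = 0 := by
    intro n
    induction n using Nat.strong_induction_on with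
    | _ n ih =>
      rintro g rfl f
      by_cases hg : ℓ g = 0
      · have := congr_fun (comm_translate g hg f) 1
        rw [apply_one] at this
        simpa [rightTranslate] using this.symm
      · obtain ⟨t, ht⟩ := h.descent g⁻¹ (by rwa [h.inv])
        have hlt : ℓ (g * s t) < ℓ g := by
          rw [← h.inv (g * s t), mul_inv_rev, h.inv_simple]
          exact ht.trans_eq (h.inv g)
        -- At $gs_t$ every term except a nonzero multiple of $(Zf)(g)$ vanishes by induction.
        have := congr_fun (comm_right t f) (g * s t)
        rw [ih _ hlt _ rfl, rightOp_apply, ih _ hlt _ rfl, h.mul_mul_self] at this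
        simpa [regularChi_ne_zero hQ] using this.symm
  ext1 f
  ext g
  exact main _ g rfl f

namespace IsInverseHeckeOp

lemma unique (h : IsLengthSystem s ℓ) (hQ : ∀ w, Q w ≠ 0) {w : G} {X Y : Module.End ℂ (G → ℂ)}
    (hX : IsInverseHeckeOp s ℓ Q w X) (hY : IsInverseHeckeOp s ℓ Q w Y) : X = Y := by
  rw [← sub_eq_zero]
  refine eq_zero_of_commute h hQ (fun t f ↦ ?_) (fun u hu f ↦ ?_) (fun f ↦ ?_)
  · simp [hX.comm_right, hY.comm_right]
  · simp [hX.comm_translate u hu, hY.comm_translate u hu]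
  · simp [hX.apply_one, hY.apply_one]

lemma leftTranslate (h : IsLengthSystem s ℓ) (hone : ∀ u, ℓ u = 0 → Q u = 1) {u : G}
    (hu : ℓ u = 0) : IsInverseHeckeOp s ℓ Q u (leftTranslate u) where
  comm_right t f := leftTranslate_rightOp h t u hu f
  comm_translate v _ f := by
    ext g; simp [AffineHecke.leftTranslate, rightTranslate, mul_assoc]
  apply_one f := by simp [AffineHecke.leftTranslate, hone u hu]

/-- The second factor is $T_j^{-1}$, so the product stands for $(T_jT_w)^{-1}$. Inverses are used
because $(T_j^{-1}f)(w)=q_j^{-1}f(s_jw)$ is a single term when $s_j$ is not a left descent of $w$,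
whereas $(T_jf)(w)$ also involves $f(w)$. -/
lemma mul_leftOp_inv (h : IsLengthSystem s ℓ)
    (hmul : ∀ v w, ℓ (v * w) = ℓ v + ℓ w → Q (v * w) = Q v * Q w) (hQ : ∀ w, Q w ≠ 0)
    {w : G} {X : Module.End ℂ (G → ℂ)} (hX : IsInverseHeckeOp s ℓ Q w X) {j : J}
    (hj : ℓ (s j * w) = ℓ w + 1) :
    IsInverseHeckeOp s ℓ Q (s j * w)
      (X * (leftOp s ℓ Q j - (Q (s j) - (Q (s j))⁻¹) • 1)) where
  comm_right t f := by
    simp only [Module.End.mul_apply, LinearMap.sub_apply, LinearMap.smul_apply,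
      Module.End.one_apply, leftOp_rightOp h hmul hQ, ← map_smul, ← map_sub, hX.comm_right]
  comm_translate u hu f := by
    simp only [Module.End.mul_apply, LinearMap.sub_apply, LinearMap.smul_apply,
      Module.End.one_apply, leftOp_rightTranslate h _ u hu, ← map_smul, ← map_sub,
      hX.comm_translate u hu]
  apply_one f := by
    have hχ : regularChi s ℓ Q j w = (Q (s j))⁻¹ := by
      rw [regularChi, if_neg (by omega)]
    rw [Module.End.mul_apply, hX.apply_one, hmul (s j) w (by rw [hj, h.length_simple, add_comm])]
    simp only [LinearMap.sub_apply, LinearMap.smul_apply, Module.End.one_apply, Pi.sub_apply,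
      Pi.smul_apply, smul_eq_mul, leftOp_apply, hχ]
    rw [mul_inv]
    ring

end IsInverseHeckeOp

lemma leftOp_mul_inv (h : IsLengthSystem s ℓ) (hQ : ∀ w, Q w ≠ 0) (j : J) :
    leftOp s ℓ Q j * (leftOp s ℓ Q j - (Q (s j) - (Q (s j))⁻¹) • 1) = 1 ∧
      (leftOp s ℓ Q j - (Q (s j) - (Q (s j))⁻¹) • 1) * leftOp s ℓ Q j = 1 := by
  constructor <;> ext1 f <;>
  simp only [Module.End.mul_apply, LinearMap.sub_apply, LinearMap.smul_apply, map_sub, map_smul,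
      Module.End.one_apply, leftOp_leftOp h hQ, add_sub_cancel_left]

lemma exists_isInverseHeckeOp (h : IsLengthSystem s ℓ)
    (hmul : ∀ v w, ℓ (v * w) = ℓ v + ℓ w → Q (v * w) = Q v * Q w) (hQ : ∀ w, Q w ≠ 0)
    (hone : ∀ u, ℓ u = 0 → Q u = 1) (w : G) :
    ∃ X : (Module.End ℂ (G → ℂ))ˣ, IsInverseHeckeOp s ℓ Q w X := by
  induction w using h.induction with
  | zero u hu =>
    refine ⟨⟨leftTranslate u, leftTranslate u⁻¹, ?_, ?_⟩, .leftTranslate h hone hu⟩ <;>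
    · ext1 f; ext g; simp [leftTranslate]
  | mul j g hg ih =>
    obtain ⟨X, hX⟩ := ih
    have hj := leftOp_mul_inv h hQ j
    exact ⟨X * ⟨_, _, hj.2, hj.1⟩, hX.mul_leftOp_inv h hmul hQ hg⟩

/-- The order is reversed because $Y$ and $X$ stand for $T_w^{-1}$ and $T_v^{-1}$. Uniqueness allows
$X$ to be replaced by the operator built from any decomposition $v=s_jg$ with $\ell(v)=\ell(g)+1$.
-/
lemma IsInverseHeckeOp.mul (h : IsLengthSystem s ℓ)
    (hmul : ∀ v w, ℓ (v * w) = ℓ v + ℓ w → Q (v * w) = Q v * Q w) (hQ : ∀ w, Q w ≠ 0)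
    (hone : ∀ u, ℓ u = 0 → Q u = 1) {v w : G} (hvw : ℓ (v * w) = ℓ v + ℓ w)
    {X Y : Module.End ℂ (G → ℂ)}
    (hX : IsInverseHeckeOp s ℓ Q v X) (hY : IsInverseHeckeOp s ℓ Q w Y) :
    IsInverseHeckeOp s ℓ Q (v * w) (Y * X) := by
  refine ⟨fun t f ↦ ?_, fun u hu f ↦ ?_, ?_⟩
  · simp [hX.comm_right, hY.comm_right]
  · simp [hX.comm_translate u hu, hY.comm_translate u hu]
  induction v using h.induction generalizing X with
  | zero u hu =>
    intro f
    rw [hX.unique h hQ (.leftTranslate h hone hu), hmul u w hvw, hone u hu]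
    simp [hY.apply_one, AffineHecke.leftTranslate]
  | mul j g hg ih =>
    obtain ⟨X', hX'⟩ := exists_isInverseHeckeOp h hmul hQ hone g
    -- A shorter left factor keeps additivity: $\le$ is subadditivity, and $\ge$ holds since $s_j$
    -- raises the length by at most one.
    have hgw : ℓ (g * w) = ℓ g + ℓ w := by
      have h1 := h.length_mul_le g w
      have h2 := h.step j (g * w)
      rw [← mul_assoc] at h2
      omega
    have hstep : IsInverseHeckeOp s ℓ Q (g * w) (Y * X') := by
      refine ⟨fun t f ↦ ?_, fun u hu f ↦ ?_, ih hgw hX'⟩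
      · simp [hX'.comm_right, hY.comm_right]
      · simp [hX'.comm_translate u hu, hY.comm_translate u hu]
    rw [hX.unique h hQ (hX'.mul_leftOp_inv h hmul hQ hg), ← mul_assoc Y, mul_assoc (s j)]
    refine (hstep.mul_leftOp_inv h hmul hQ ?_).apply_one
    rw [← mul_assoc]
    omega

/-- The regular representation of the Hecke algebra on functions on the group. -/
theorem exists_regular_representation (h : IsLengthSystem s ℓ)
    (hmul : ∀ v w, ℓ (v * w) = ℓ v + ℓ w → Q (v * w) = Q v * Q w) (hQ : ∀ w, Q w ≠ 0)
    (hone : ∀ u, ℓ u = 0 → Q u = 1) :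
    ∃ T : G → Module.End ℂ (G → ℂ), (∀ j, T (s j) = leftOp s ℓ Q j) ∧
      (∀ u, ℓ u = 0 → T u = leftTranslate u⁻¹) ∧
      ∀ v w, ℓ (v * w) = ℓ v + ℓ w → T (v * w) = T v * T w := by
  choose X hX using exists_isInverseHeckeOp h hmul hQ hone
  refine ⟨fun w ↦ ↑(X w)⁻¹, fun j ↦ ?_, fun u hu ↦ ?_, fun v w hvw ↦ ?_⟩
  · refine Units.inv_eq_of_mul_eq_one_right ?_
    have h1 : IsInverseHeckeOp s ℓ Q 1 1 := by
      convert IsInverseHeckeOp.leftTranslate h hone h.one using 1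
      ext1 f; ext g; simp [leftTranslate]
    have h2 := h1.mul_leftOp_inv h hmul hQ (j := j) (by rw [mul_one, h.length_simple, h.one])
    rw [mul_one, one_mul] at h2
    rw [(hX (s j)).unique h hQ h2, (leftOp_mul_inv h hQ j).2]
  · refine Units.inv_eq_of_mul_eq_one_right ?_
    rw [(hX u).unique h hQ (.leftTranslate h hone hu)]
    ext1 f; ext g; simp [leftTranslate]
  · have := (hX (v * w)).unique h hQ ((hX v).mul h hmul hQ hone hvw (hX w))
    have : X (v * w) = X w * X v := Units.ext this
    simp [this]

end Regular

end AffineHecke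

/-! ### Affine roots and the action of $W$ on them -/

namespace AffineHecke

section AffineRoots

variable {ι V V' : Type*} [AddCommGroup V] [Module ℝ V] [AddCommGroup V'] [Module ℝ V']
  (Φ : RootPairing ι ℝ V V')

/-- The affine root `x ↦ ⟨x, α^∨⟩ - k` vanishing on the hyperplane `V_{α,k}`. -/
def affineRoot (p : ι × ℤ) (x : V) : ℝ := Φ.coroot' p.1 x - p.2

/-- The index of the negative of an affine root. -/
def negIndex (p : ι × ℤ) : ι × ℤ := (Φ.reflectionPerm p.1 p.1, -p.2)

lemma coroot'_reflectionPerm_self (i : ι) (x : V) :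
    Φ.coroot' (Φ.reflectionPerm i i) x = -Φ.coroot' i x := by
  simp [RootPairing.coroot']

lemma affineRoot_negIndex (p : ι × ℤ) (x : V) :
    affineRoot Φ (negIndex Φ p) x = -affineRoot Φ p x := by
  rw [affineRoot, affineRoot, negIndex, coroot'_reflectionPerm_self]
  push_cast
  ring

lemma eq_of_forall_affineRoot_eq {p p' : ι × ℤ}
    (h : ∀ x, affineRoot Φ p x = affineRoot Φ p' x) : p = p' := by
  have h0 : p.2 = p'.2 := by
    have := h 0
    simpa [affineRoot] using this
  refine Prod.ext (Φ.coroot.injective ?_) h0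
  have : Function.Injective Φ.toLinearMap.flip := (Φ.toLinearMap.flip.toPerfPair).injective
  apply this
  ext x
  have := h x
  rw [affineRoot, affineRoot, h0, sub_left_inj] at this
  exact this

lemma negIndex_negIndex (p : ι × ℤ) : negIndex Φ (negIndex Φ p) = p :=
  eq_of_forall_affineRoot_eq Φ fun x ↦ by simp [affineRoot_negIndex]

lemma affineReflection_eq (p : ι × ℤ) (x : V) :
    affineReflection Φ p.1 p.2 x = x - affineRoot Φ p x • Φ.root p.1 :=
  affineReflection_apply Φ _ _ _

lemma affineRoot_affineReflection (p : ι × ℤ) (x : V) :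
    affineRoot Φ p (affineReflection Φ p.1 p.2 x) = -affineRoot Φ p x := by
  rw [affineReflection_eq]
  simp only [affineRoot, map_sub, map_smul, Φ.root_coroot'_eq_pairing, Φ.pairing_same, smul_eq_mul]
  ring

lemma affineReflection_negIndex (p : ι × ℤ) :
    affineReflection Φ (negIndex Φ p).1 (negIndex Φ p).2 = affineReflection Φ p.1 p.2 := by
  ext x
  rw [affineReflection_eq, affineReflection_eq, affineRoot_negIndex]
  simp [negIndex]

lemma affineReflection_mul_self (p : ι × ℤ) :
    affineReflection Φ p.1 p.2 * affineReflection Φ p.1 p.2 = 1 := by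
  ext x
  rw [AffineEquiv.coe_mul, Function.comp_apply, affineReflection_eq, affineRoot_affineReflection,
    affineReflection_eq, AffineEquiv.coe_one, id]
  module

/-- A reflection $s_{\alpha,0}$ permutes the roots, and a translation by $\lambda\in P$ shifts $k$
by the integer $\langle\lambda,\alpha^\vee\rangle$. The second clause, on the linear part of $w$,
serves to conjugate reflections in `affineReflection_comp`. -/
lemma exists_affineRoot_comp (w : V ≃ᵃ[ℝ] V) (hw : w ∈ affineWeylGroup Φ) (p : ι × ℤ) :
    ∃ p' : ι × ℤ, (∀ x, affineRoot Φ p (w x) = affineRoot Φ p' x) ∧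
      ∀ x (c : ℝ), w (x + c • Φ.root p'.1) = w x + c • Φ.root p.1 := by
  suffices h : ∀ p : ι × ℤ, (∃ p' : ι × ℤ, (∀ x, affineRoot Φ p (w x) = affineRoot Φ p' x) ∧
      ∀ x (c : ℝ), w (x + c • Φ.root p'.1) = w x + c • Φ.root p.1) ∧
      (∃ p' : ι × ℤ, (∀ x, affineRoot Φ p (w⁻¹ x) = affineRoot Φ p' x) ∧
      ∀ x (c : ℝ), w⁻¹ (x + c • Φ.root p'.1) = w⁻¹ x + c • Φ.root p.1) from (h p).1
  clear p
  induction hw using Subgroup.closure_induction with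
  | mem g hg =>
    rintro ⟨j, k⟩
    rcases hg with ⟨i, rfl⟩ | ⟨v, hv, rfl⟩
    · have hinv : (affineReflection Φ i 0)⁻¹ = affineReflection Φ i 0 :=
        inv_eq_of_mul_eq_one_left (affineReflection_mul_self Φ (i, 0))
      rw [hinv, and_self]
      have hr : ∀ x, affineReflection Φ i 0 x = Φ.reflection i x := by
        intro x
        rw [affineReflection_apply, Φ.reflection_apply, Int.cast_zero, sub_zero]
      refine ⟨(Φ.reflectionPerm i j, k), fun x ↦ ?_, fun x c ↦ ?_⟩
      · rw [affineRoot, affineRoot, hr, Φ.coroot'_reflection]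
      · rw [hr, hr, map_add, map_smul, ← Φ.root_reflectionPerm, Φ.reflectionPerm_self]
    · obtain ⟨m, hm⟩ := hv j
      have hinv : ∀ x, (translation v)⁻¹ x = -v + x := by
        intro x
        rw [AffineEquiv.inv_def, translation, AffineEquiv.constVAdd_symm]
        rfl
      have hvx : ∀ x, translation v x = v + x := fun x ↦ rfl
      refine ⟨⟨(j, k - m), fun x ↦ ?_, fun x c ↦ ?_⟩, ⟨(j, k + m), fun x ↦ ?_, fun x c ↦ ?_⟩⟩
      · simp only [affineRoot, hvx, map_add, hm]; push_cast; ring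
      · simp only [hvx]; module
      · simp only [affineRoot, hinv, map_add, map_neg, hm]; push_cast; ring
      · simp only [hinv]; module
  | one => intro p; exact ⟨⟨p, by simp⟩, ⟨p, by simp⟩⟩
  | mul v w _ _ hv hw =>
    intro p
    rw [mul_inv_rev]
    constructor
    · obtain ⟨p₁, h₁, h₁'⟩ := (hv p).1
      obtain ⟨p₂, h₂, h₂'⟩ := (hw p₁).1
      exact ⟨p₂, by simp [h₁, h₂], by simp [h₁', h₂']⟩
    · obtain ⟨p₁, h₁, h₁'⟩ := (hw p).2
      obtain ⟨p₂, h₂, h₂'⟩ := (hv p₁).2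
      exact ⟨p₂, by simp [h₁, h₂], by simp [h₁', h₂']⟩
  | inv w _ hw => intro p; rw [inv_inv]; exact (hw p).symm

/-- The action of `W` on (the indices of) affine roots by composition. -/
noncomputable def pullIndex (w : affineWeylGroup Φ) (p : ι × ℤ) : ι × ℤ :=
  (exists_affineRoot_comp Φ w.1 w.2 p).choose

lemma affineRoot_pullIndex (w : affineWeylGroup Φ) (p : ι × ℤ) (x : V) :
    affineRoot Φ (pullIndex Φ w p) x = affineRoot Φ p (w.1 x) :=
  ((exists_affineRoot_comp Φ w.1 w.2 p).choose_spec.1 x).symm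

lemma affineReflection_comp (w : affineWeylGroup Φ) (p : ι × ℤ) (x : V) :
    affineReflection Φ p.1 p.2 (w.1 x) =
      w.1 (affineReflection Φ (pullIndex Φ w p).1 (pullIndex Φ w p).2 x) := by
  rw [affineReflection_eq, affineReflection_eq, sub_eq_add_neg x, ← neg_smul,
    pullIndex, (exists_affineRoot_comp Φ w.1 w.2 p).choose_spec.2, ← pullIndex,
    affineRoot_pullIndex, neg_smul, sub_eq_add_neg]

lemma coe_inv_apply_apply (w : affineWeylGroup Φ) (x : V) : (w⁻¹).1 (w.1 x) = x := by
  rw [← Function.comp_apply (f := (w⁻¹).1), ← AffineEquiv.coe_mul, ← Subgroup.coe_mul]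
  simp

lemma coe_apply_inv_apply (w : affineWeylGroup Φ) (x : V) : w.1 ((w⁻¹).1 x) = x := by
  simpa using coe_inv_apply_apply Φ w⁻¹ x

lemma coe_mul_apply (v w : affineWeylGroup Φ) (x : V) : (v * w).1 x = v.1 (w.1 x) := rfl

lemma pullIndex_bijective (w : affineWeylGroup Φ) : Function.Bijective (pullIndex Φ w) := by
  have h : ∀ (v : affineWeylGroup Φ) p, pullIndex Φ v⁻¹ (pullIndex Φ v p) = p := fun v p ↦
    eq_of_forall_affineRoot_eq Φ fun x ↦ by
      rw [affineRoot_pullIndex, affineRoot_pullIndex, coe_apply_inv_apply]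
  exact ⟨Function.LeftInverse.injective (h w),
    Function.RightInverse.surjective (g := pullIndex Φ w⁻¹)
      fun p ↦ by simpa using h w⁻¹ p⟩

/-- The affine roots whose hyperplane separates `x` and `y`. -/
def separatingRoots (x y : V) : Set (ι × ℤ) := {p | affineRoot Φ p x * affineRoot Φ p y < 0}

/-- Opposite signs force $k$ between $\langle x,\alpha^\vee\rangle$ and $\langle
y,\alpha^\vee\rangle$. -/
lemma finite_separatingRoots [Finite ι] (x y : V) : (separatingRoots Φ x y).Finite := by
  let B : ι → ℝ := fun i ↦ |Φ.coroot' i x| + |Φ.coroot' i y|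
  refine (Set.finite_iUnion (f := fun i ↦ ({i} : Set ι) ×ˢ Set.Icc ⌊-B i⌋ ⌈B i⌉)
    fun i ↦ (Set.finite_singleton i).prod (Set.finite_Icc _ _)).subset ?_
  rintro ⟨i, k⟩ h
  simp only [separatingRoots, affineRoot, Set.mem_ofPred_eq] at h
  simp only [Set.mem_iUnion, Set.mem_prod, Set.mem_singleton_iff, Set.mem_Icc]
  have h1 := abs_nonneg (Φ.coroot' i x)
  have h2 := abs_nonneg (Φ.coroot' i y)
  have h3 := le_abs_self (Φ.coroot' i x)
  have h4 := le_abs_self (Φ.coroot' i y)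
  have h5 := neg_abs_le (Φ.coroot' i x)
  have h6 := neg_abs_le (Φ.coroot' i y)
  have hk : -B i ≤ k ∧ (k : ℝ) ≤ B i := by
    simp only [B]
    rcases mul_neg_iff.mp h with h | h <;> constructor <;> linarith
  refine ⟨i, rfl, ?_, ?_⟩
  · exact_mod_cast (Int.floor_le _).trans hk.1
  · exact_mod_cast hk.2.trans (Int.le_ceil _)

end AffineRoots

/-! ### Positive coroots, the alcove and its walls -/

section Alcove

variable {ι V V' : Type*} [AddCommGroup V] [Module ℝ V] [AddCommGroup V'] [Module ℝ V']
  {Φ : RootPairing ι ℝ V V'} (b : Φ.Base)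

lemma isPos_or_isPos_negIndex (p : ι × ℤ) : b.IsPos p.1 ∨ b.IsPos (negIndex Φ p).1 :=
  Base.IsPos.or_neg b p.1

lemma isPos_negIndex_iff (p : ι × ℤ) : b.IsPos (negIndex Φ p).1 ↔ ¬ b.IsPos p.1 :=
  Base.IsPos.neg_iff_not b p.1

/-- Points at which the simple coroots take prescribed values. -/
lemma exists_forall_coroot'_eq [Φ.IsRootSystem] (c : b.support → ℝ) :
    ∃ x : V, ∀ j : b.support, Φ.coroot' j x = c j := by
  refine ⟨Φ.toLinearMap.toPerfPair.symm (b.toCoweightBasis.constr ℝ c), fun j ↦ ?_⟩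
  change Φ.toLinearMap.toPerfPair (Φ.toLinearMap.toPerfPair.symm _) (Φ.coroot j) = _
  rw [LinearEquiv.apply_symm_apply, ← b.toCoweightBasis_apply, Module.Basis.constr_basis]

/-- The value of a covector at a point. -/
def evalAt (Φ : RootPairing ι ℝ V V') (x : V) : V' →ₗ[ℝ] ℝ := Φ.toLinearMap x

lemma evalAt_coroot (Φ : RootPairing ι ℝ V V') (x : V) (i : ι) :
    evalAt Φ x (Φ.coroot i) = Φ.coroot' i x := rfl

lemma evalAt_nonneg {x : V} (hx : ∀ j ∈ b.support, 0 ≤ Φ.coroot' j x) {v : V'}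
    (hv : v ∈ AddSubmonoid.closure (Φ.coroot '' b.support)) : 0 ≤ evalAt Φ x v := by
  induction hv using AddSubmonoid.closure_induction with
  | mem v hv => obtain ⟨j, hj, rfl⟩ := hv; exact hx j hj
  | zero => simp
  | add v w _ _ hv hw => rw [map_add]; exact add_nonneg hv hw

variable {b} in
lemma coroot'_le_highest {i₀ : ι} (hi₀ : IsHighestCoroot b i₀) {x : V}
    (hx : ∀ j ∈ b.support, 0 ≤ Φ.coroot' j x) (i : ι) :
    Φ.coroot' i x ≤ Φ.coroot' i₀ x := by
  have := evalAt_nonneg b hx (hi₀ i)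
  rwa [map_sub, evalAt_coroot, evalAt_coroot, sub_nonneg] at this

lemma eq_zero_or_evalAt_pos {x : V} (hx : ∀ j ∈ b.support, 0 < Φ.coroot' j x) {v : V'}
    (hv : v ∈ AddSubmonoid.closure (Φ.coroot '' b.support)) : v = 0 ∨ 0 < evalAt Φ x v := by
  induction hv using AddSubmonoid.closure_induction with
  | mem v hv => obtain ⟨j, hj, rfl⟩ := hv; exact Or.inr (hx j hj)
  | zero => simp
  | add v w _ _ hv hw =>
    rw [map_add]
    rcases hv with rfl | hv <;> rcases hw with rfl | hw
    · simp
    · simpa using Or.inr hw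
    · simpa using Or.inr hv
    · exact Or.inr (add_pos hv hw)

lemma eq_nsmul_or_evalAt_pos {x : V} {j : ι} (h0 : Φ.coroot' j x = 0)
    (hx : ∀ k ∈ b.support, k ≠ j → 0 < Φ.coroot' k x) {v : V'}
    (hv : v ∈ AddSubmonoid.closure (Φ.coroot '' b.support)) :
    (∃ n : ℕ, v = n • Φ.coroot j) ∨ 0 < evalAt Φ x v := by
  have hj : evalAt Φ x (Φ.coroot j) = 0 := h0
  induction hv using AddSubmonoid.closure_induction with
  | mem v hv =>
    obtain ⟨k, hk, rfl⟩ := hv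
    by_cases hkj : k = j
    · exact Or.inl ⟨1, by simp [hkj]⟩
    · exact Or.inr (hx k hk hkj)
  | zero => exact Or.inl ⟨0, by simp⟩
  | add v w _ _ hv hw =>
    rw [map_add]
    rcases hv with ⟨n, rfl⟩ | hv <;> rcases hw with ⟨m, rfl⟩ | hw
    · exact Or.inl ⟨n + m, (add_smul _ _ _).symm⟩
    · right; simpa [hj] using hw
    · right; simpa [hj] using hv
    · exact Or.inr (add_pos hv hw)

variable [Finite ι] [Φ.IsCrystallographic] [Φ.IsReduced]

/-- For roots and coroots alike, a simple reflection permutes the positive ones other than its own,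
so positivity transfers along chains of simple reflections. The motive is conditional because the
induction step supplies no positivity for the intermediate roots. -/
lemma flip_isPos_of_isPos {i : ι} (hi : b.IsPos i) : b.flip.IsPos i := by
  refine hi.induction_on_reflect (p := fun k ↦ b.IsPos k → b.flip.IsPos k) ?_ ?_ hi
  · intro k hk _
    exact Base.isPos_of_mem_support (b := b.flip) hk
  · intro k j hk hj hpos
    by_cases hkj : Φ.reflectionPerm j k = j
    · rw [hkj]
      exact Base.isPos_of_mem_support (b := b.flip) hj
    · have h1 : b.IsPos k := by
        have := hpos.reflectionPerm hj hkj
        rwa [Φ.reflectionPerm_self] at this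
      have hne : k ≠ j := by
        rintro rfl
        exact (Base.IsPos.neg_iff_not b k).mp hpos h1
      exact Base.IsPos.reflectionPerm (b := b.flip) (hk h1) hj hne

lemma coroot_mem_closure_of_isPos {i : ι} (hi : b.IsPos i) :
    Φ.coroot i ∈ AddSubmonoid.closure (Φ.coroot '' b.support) := by
  refine (flip_isPos_of_isPos b hi).induction_on_add
    (p := fun k ↦ Φ.coroot k ∈ AddSubmonoid.closure (Φ.coroot '' b.support)) ?_ ?_
  · exact fun k hk ↦ AddSubmonoid.subset_closure ⟨k, hk, rfl⟩
  · intro k j l hl hk hj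
    have hl : Φ.coroot l = Φ.coroot k + Φ.coroot j := hl
    rw [hl]
    exact add_mem hk (AddSubmonoid.subset_closure ⟨j, hj, rfl⟩)

lemma coroot'_nonneg {x : V} (hx : ∀ j ∈ b.support, 0 ≤ Φ.coroot' j x) {i : ι}
    (hi : b.IsPos i) : 0 ≤ Φ.coroot' i x :=
  evalAt_nonneg b hx (coroot_mem_closure_of_isPos b hi)

lemma coroot'_pos {x : V} (hx : ∀ j ∈ b.support, 0 < Φ.coroot' j x) {i : ι}
    (hi : b.IsPos i) : 0 < Φ.coroot' i x :=
  (eq_zero_or_evalAt_pos b hx (coroot_mem_closure_of_isPos b hi)).resolve_left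
    (Φ.flip.ne_zero i)

/-- A positive root whose coroot vanishes at a generic point of a simple wall is that simple
root. -/
lemma eq_of_coroot'_eq_zero {x : V} {j : ι} (hj : j ∈ b.support) (h0 : Φ.coroot' j x = 0)
    (hx : ∀ k ∈ b.support, k ≠ j → 0 < Φ.coroot' k x) {i : ι}
    (hi : b.IsPos i) (hix : Φ.coroot' i x = 0) : i = j := by
  rcases eq_nsmul_or_evalAt_pos b h0 hx (coroot_mem_closure_of_isPos b hi) with ⟨n, hn⟩ | h
  · by_contra hij
    have hneg : Φ.coroot i ≠ -Φ.coroot j := by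
      intro hc
      have : i = Φ.reflectionPerm j j := Φ.coroot_eq_neg_iff.mp hc
      have hjp := Base.isPos_of_mem_support hj
      rw [this] at hi
      exact (Base.IsPos.neg_iff_not b j).mp hi hjp
    have := IsReduced.linearIndependent Φ.flip hij hneg
    rw [LinearIndependent.pair_iff] at this
    have := (this 1 (-(n : ℝ)) (by
      change (1 : ℝ) • Φ.coroot i + (-(n : ℝ)) • Φ.coroot j = 0
      rw [hn, ← Nat.cast_smul_eq_nsmul ℝ]; module)).1
    exact one_ne_zero this
  · rw [evalAt_coroot, hix] at h
    exact absurd h (lt_irrefl _)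

variable [Φ.IsRootSystem]

variable {b} in
lemma IsHighestCoroot.isPos {i₀ : ι} (hi₀ : IsHighestCoroot b i₀) : b.IsPos i₀ := by
  obtain ⟨x, hx⟩ := exists_forall_coroot'_eq b fun _ ↦ 1
  have hx' : ∀ j ∈ b.support, 0 < Φ.coroot' j x := fun j hj ↦ by rw [hx ⟨j, hj⟩]; exact one_pos
  refine (Base.IsPos.or_neg b i₀).resolve_right fun h ↦ ?_
  have h1 := coroot'_pos b hx' h
  have h2 := coroot'_le_highest hi₀ (fun j hj ↦ (hx' j hj).le) (Φ.reflectionPerm i₀ i₀)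
  have h3 := coroot'_reflectionPerm_self Φ i₀ x
  change 0 < Φ.coroot' (Φ.reflectionPerm i₀ i₀) x at h1
  linarith

lemma exists_mem_alcove {i₀ : ι} (hi₀ : IsHighestCoroot b i₀) : ∃ x, x ∈ alcove b := by
  obtain ⟨x, hx⟩ := exists_forall_coroot'_eq b fun _ ↦ 1
  have hx' : ∀ j ∈ b.support, 0 < Φ.coroot' j x := fun j hj ↦ by rw [hx ⟨j, hj⟩]; exact one_pos
  have h0 := coroot'_pos b hx' hi₀.isPos
  -- The scaling brings the highest coroot below $1$, hence all the others too.
  refine ⟨(Φ.coroot' i₀ x + 1)⁻¹ • x, fun i hi ↦ ?_⟩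
  have h1 := coroot'_pos b hx' hi
  have h2 := coroot'_le_highest hi₀ (fun j hj ↦ (hx' j hj).le) i
  rw [map_smul, smul_eq_mul]
  refine ⟨by positivity, ?_⟩
  rw [inv_mul_lt_one₀ (by positivity)]
  linarith

/-- Each wall of the alcove has a point in its closure that lies on no other root hyperplane. -/
lemma exists_generic_point_of_wall {i₀ : ι} (hi₀ : IsHighestCoroot b i₀) (j : Option b.support) :
    ∃ z, affineRoot Φ (wall b i₀ j) z = 0 ∧ ∀ i, b.IsPos i →
      (0 ≤ Φ.coroot' i z ∧ (Φ.coroot' i z = 0 → (i, 0) = wall b i₀ j)) ∧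
      (Φ.coroot' i z ≤ 1 ∧ (Φ.coroot' i z = 1 → (i, 1) = wall b i₀ j)) := by
  cases j with
  | none =>
    obtain ⟨x, hx⟩ := exists_forall_coroot'_eq b fun _ ↦ 1
    have hx' : ∀ j ∈ b.support, 0 < Φ.coroot' j x := fun j hj ↦ by
      rw [hx ⟨j, hj⟩]; exact one_pos
    have h0 := coroot'_pos b hx' hi₀.isPos
    -- Here the highest coroot takes the value exactly $1$. Another coroot with value $1$ would
    -- differ from it by a combination of simple coroots that vanishes where all of them are
    -- positive.
    refine ⟨(Φ.coroot' i₀ x)⁻¹ • x, ?_, fun i hi ↦ ?_⟩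
    · simp only [affineRoot, wall, map_smul, smul_eq_mul, inv_mul_cancel₀ h0.ne', Int.cast_one,
        sub_self]
    · have h1 := coroot'_pos b hx' hi
      have h2 := coroot'_le_highest hi₀ (fun j hj ↦ (hx' j hj).le) i
      rw [map_smul, smul_eq_mul]
      have h3 : 0 < (Φ.coroot' i₀ x)⁻¹ * Φ.coroot' i x := by positivity
      refine ⟨⟨h3.le, fun h ↦ absurd h h3.ne'⟩, ?_, fun h ↦ ?_⟩
      · rwa [inv_mul_le_one₀ h0]
      · rw [inv_mul_eq_one₀ h0.ne'] at h
        rcases eq_zero_or_evalAt_pos b hx' (hi₀ i) with h4 | h4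
        · rw [← Φ.coroot.injective (sub_eq_zero.mp h4)]
          rfl
        · rw [map_sub, evalAt_coroot, evalAt_coroot, h, sub_self] at h4
          exact absurd h4 (lt_irrefl _)
  | some j =>
    classical
    obtain ⟨x, hx⟩ := exists_forall_coroot'_eq b fun k ↦ if k = j then 0 else 1
    have h0 : Φ.coroot' j x = 0 := by rw [hx, if_pos rfl]
    have hx' : ∀ k ∈ b.support, k ≠ j → 0 < Φ.coroot' k x := fun k hk hkj ↦ by
      rw [hx ⟨k, hk⟩, if_neg (fun h ↦ hkj (congrArg Subtype.val h))]; exact one_pos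
    have hx0 : ∀ k ∈ b.support, 0 ≤ Φ.coroot' k x := fun k hk ↦ by
      by_cases hkj : k = j
      · rw [hkj, h0]
      · exact (hx' k hk hkj).le
    have hθ := coroot'_nonneg b hx0 hi₀.isPos
    have hc : 0 < (Φ.coroot' i₀ x + 1)⁻¹ := by positivity
    refine ⟨(Φ.coroot' i₀ x + 1)⁻¹ • x, ?_, fun i hi ↦ ?_⟩
    · simp [affineRoot, wall, h0]
    · have h1 := coroot'_nonneg b hx0 hi
      have h2 := coroot'_le_highest hi₀ hx0 i
      rw [map_smul, smul_eq_mul]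
      have h3 : (Φ.coroot' i₀ x + 1)⁻¹ * Φ.coroot' i x < 1 := by
        rw [inv_mul_lt_one₀ (by positivity)]
        linarith
      refine ⟨⟨by positivity, fun h ↦ ?_⟩, h3.le, fun h ↦ absurd h h3.ne⟩
      rw [eq_of_coroot'_eq_zero b j.2 h0 hx' hi ((mul_eq_zero_iff_left hc.ne').mp h)]
      rfl

section Signs

omit [Finite ι] [Φ.IsCrystallographic] [Φ.IsReduced] [Φ.IsRootSystem]

/-- It suffices to verify statements about signs of affine roots for positive roots. -/
lemma forall_affineRoot_mul {x y : V} (r : ℝ → Prop)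
    (h : ∀ p : ι × ℤ, b.IsPos p.1 → r (affineRoot Φ p x * affineRoot Φ p y)) (p : ι × ℤ) :
    r (affineRoot Φ p x * affineRoot Φ p y) := by
  rcases isPos_or_isPos_negIndex b p with hp | hp
  · exact h p hp
  · simpa [affineRoot_negIndex] using h _ hp

variable {b}

/-- No integer lies strictly between $0$ and $1$, so no affine root changes sign on the closed
alcove. -/
lemma affineRoot_mul_nonneg {x y : V} (hx : x ∈ alcove b)
    (hy : ∀ i, b.IsPos i → 0 ≤ Φ.coroot' i y ∧ Φ.coroot' i y ≤ 1) (p : ι × ℤ) :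
    0 ≤ affineRoot Φ p x * affineRoot Φ p y := by
  refine forall_affineRoot_mul b (0 ≤ ·) (fun p hp ↦ ?_) p
  have h1 := hx p.1 hp
  have h2 := hy p.1 hp
  simp only [affineRoot]
  rcases le_or_gt p.2 0 with h | h
  · have : (p.2 : ℝ) ≤ 0 := by exact_mod_cast h
    exact mul_nonneg (by linarith) (by linarith)
  · have : (1 : ℝ) ≤ p.2 := by exact_mod_cast h
    exact mul_nonneg_of_nonpos_of_nonpos (by linarith) (by linarith)

lemma affineRoot_ne_zero {x : V} (hx : x ∈ alcove b) (p : ι × ℤ) : affineRoot Φ p x ≠ 0 := by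
  have := forall_affineRoot_mul b (x := x) (y := x) (· ≠ 0) (fun p hp ↦ ?_) p
  · exact fun h ↦ this (by simp [h])
  · have h1 := hx p.1 hp
    simp only [affineRoot]
    intro h0
    have h2 : Φ.coroot' p.1 x = p.2 := by nlinarith
    rw [h2] at h1
    have h3 : 0 < p.2 := by exact_mod_cast h1.1
    have h4 : p.2 < 1 := by exact_mod_cast h1.2
    omega

lemma affineRoot_mul_pos {x y : V} (hx : x ∈ alcove b) (hy : y ∈ alcove b) (p : ι × ℤ) :
    0 < affineRoot Φ p x * affineRoot Φ p y :=
  (affineRoot_mul_nonneg hx (fun i hi ↦ ⟨(hy i hi).1.le, (hy i hi).2.le⟩) p).lt_of_ne'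
    (mul_ne_zero (affineRoot_ne_zero hx p) (affineRoot_ne_zero hy p))

lemma mem_alcove_of_affineRoot_mul_pos {x y : V} (hx : x ∈ alcove b)
    (h : ∀ p, 0 < affineRoot Φ p x * affineRoot Φ p y) : y ∈ alcove b := by
  intro i hi
  have h1 := hx i hi
  have h2 := h (i, 0)
  have h3 := h (i, 1)
  simp only [affineRoot, Int.cast_zero, Int.cast_one, sub_zero] at h2 h3
  exact ⟨pos_of_mul_pos_right h2 h1.1.le, by nlinarith⟩

/-- Sign comparison transfers along points on the same side of every hyperplane. -/
lemma mul_neg_iff_of_mul_pos {a a' c : ℝ} (h : 0 < a * a') : a * c < 0 ↔ a' * c < 0 := by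
  rw [mul_pos_iff] at h
  rw [mul_neg_iff, mul_neg_iff]
  grind

end Signs

end Alcove

end AffineHecke

/-! ### Length as a count of separating affine roots -/

namespace AffineHecke

variable {ι V V' : Type*} [AddCommGroup V] [Module ℝ V] [AddCommGroup V'] [Module ℝ V']
  {Φ : RootPairing ι ℝ V V'} {b : Φ.Base} {i₀ : ι}

section Length

lemma separates_iff_affineRoot {S T : Set V} {i : ι} {k : ℤ} :
    Separates Φ i k S T ↔
      ((∀ x ∈ S, affineRoot Φ (i, k) x < 0) ∧ ∀ y ∈ T, 0 < affineRoot Φ (i, k) y) ∨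
      ((∀ x ∈ S, 0 < affineRoot Φ (i, k) x) ∧ ∀ y ∈ T, affineRoot Φ (i, k) y < 0) := by
  simp only [Separates, affineRoot, sub_neg, sub_pos]

lemma affineRoot_apply_mul_pos {x y : V} (hx : x ∈ alcove b) (hy : y ∈ alcove b)
    (w : affineWeylGroup Φ) (p : ι × ℤ) : 0 < affineRoot Φ p (w.1 x) * affineRoot Φ p (w.1 y) := by
  rw [← affineRoot_pullIndex, ← affineRoot_pullIndex]
  exact affineRoot_mul_pos hx hy _

lemma affineRoot_apply_ne_zero {x : V} (hx : x ∈ alcove b)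
    (w : affineWeylGroup Φ) (p : ι × ℤ) : affineRoot Φ p (w.1 x) ≠ 0 := by
  rw [← affineRoot_pullIndex]
  exact affineRoot_ne_zero hx _

lemma separates_alcove_iff {x : V} (hx : x ∈ alcove b) (w : affineWeylGroup Φ) (p : ι × ℤ) :
    Separates Φ p.1 p.2 (alcove b) (w.1 '' alcove b) ↔ p ∈ separatingRoots Φ x (w.1 x) := by
  rw [separates_iff_affineRoot, separatingRoots, Set.mem_ofPred_eq, mul_neg_iff]
  constructor
  · rintro (⟨h1, h2⟩ | ⟨h1, h2⟩)
    · exact Or.inr ⟨h1 x hx, h2 _ ⟨x, hx, rfl⟩⟩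
    · exact Or.inl ⟨h1 x hx, h2 _ ⟨x, hx, rfl⟩⟩
  · rintro (⟨h1, h2⟩ | ⟨h1, h2⟩)
    · refine Or.inr ⟨fun y hy ↦ ?_, ?_⟩
      · exact pos_of_mul_pos_right (affineRoot_mul_pos hx hy p) h1.le
      · rintro _ ⟨y, hy, rfl⟩
        exact neg_of_mul_pos_right (affineRoot_apply_mul_pos hx hy w p) h2.le
    · refine Or.inl ⟨fun y hy ↦ ?_, ?_⟩
      · exact neg_of_mul_pos_right (affineRoot_mul_pos hx hy p) h1.le
      · rintro _ ⟨y, hy, rfl⟩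
        exact pos_of_mul_pos_right (affineRoot_apply_mul_pos hx hy w p) h2.le

lemma separates_singleton_alcove_iff {x y : V} (hx : x ∈ alcove b) (p : ι × ℤ) :
    Separates Φ p.1 p.2 {y} (alcove b) ↔ affineRoot Φ p x * affineRoot Φ p y < 0 := by
  rw [separates_iff_affineRoot, mul_neg_iff]
  simp only [Set.mem_singleton_iff, forall_eq]
  constructor
  · rintro (⟨h1, h2⟩ | ⟨h1, h2⟩)
    · exact Or.inl ⟨h2 x hx, h1⟩
    · exact Or.inr ⟨h2 x hx, h1⟩
  · rintro (⟨h1, h2⟩ | ⟨h1, h2⟩)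
    · exact Or.inl ⟨h2, fun z hz ↦ pos_of_mul_pos_right (affineRoot_mul_pos hx hz p) h1.le⟩
    · exact Or.inr ⟨h2, fun z hz ↦ neg_of_mul_pos_right (affineRoot_mul_pos hx hz p) h1.le⟩

lemma negIndex_mem_separatingRoots {x y : V} {p : ι × ℤ} :
    negIndex Φ p ∈ separatingRoots Φ x y ↔ p ∈ separatingRoots Φ x y := by
  simp [separatingRoots, affineRoot_negIndex]

variable [Finite ι]

/-- Each separating hyperplane carries two affine roots of opposite sign. Counting both makes the
set compatible with the action of $W$, which does not preserve positivity. -/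
lemma two_mul_length {x : V} (hx : x ∈ alcove b) (w : affineWeylGroup Φ) :
    2 * length b w = (separatingRoots Φ x (w.1 x)).ncard := by
  set D := {p : ι × ℤ | b.IsPos p.1 ∧ Separates Φ p.1 p.2 (alcove b) (w.1 '' alcove b)} with hD
  have hfin := finite_separatingRoots Φ x (w.1 x)
  have hsub : D ⊆ separatingRoots Φ x (w.1 x) := fun p hp ↦ (separates_alcove_iff hx w p).mp hp.2
  have hunion : separatingRoots Φ x (w.1 x) = D ∪ negIndex Φ '' D := by
    ext p
    constructor
    · intro hp
      rcases isPos_or_isPos_negIndex b p with h | h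
      · exact Or.inl ⟨h, (separates_alcove_iff hx w p).mpr hp⟩
      · exact Or.inr ⟨negIndex Φ p, ⟨h, (separates_alcove_iff hx w _).mpr
          (negIndex_mem_separatingRoots.mpr hp)⟩, negIndex_negIndex Φ p⟩
    · rintro (hp | ⟨p, hp, rfl⟩)
      · exact hsub hp
      · exact negIndex_mem_separatingRoots.mpr (hsub hp)
  have hdisj : Disjoint D (negIndex Φ '' D) := by
    rw [Set.disjoint_left]
    rintro _ h ⟨p, hp, rfl⟩
    exact (isPos_negIndex_iff b p).mp h.1 hp.1
  have hDfin := hfin.subset hsub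
  rw [hunion, Set.ncard_union_eq hdisj hDfin (hDfin.image _),
    Set.ncard_image_of_injective _ (Function.LeftInverse.injective (negIndex_negIndex Φ)),
    two_mul]
  rfl

lemma length_eq_zero_iff_mem_alcove {x : V} (hx : x ∈ alcove b) (w : affineWeylGroup Φ) :
    length b w = 0 ↔ w.1 x ∈ alcove b := by
  have h := two_mul_length hx w
  have h' : length b w = 0 ↔ separatingRoots Φ x (w.1 x) = ∅ := by
    rw [← Set.ncard_eq_zero (finite_separatingRoots Φ x _)]
    omega
  rw [h', Set.eq_empty_iff_forall_notMem]
  constructor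
  · intro hp
    refine mem_alcove_of_affineRoot_mul_pos hx fun p ↦ (not_lt.mp (hp p)).lt_of_ne' ?_
    exact mul_ne_zero (affineRoot_ne_zero hx p) (affineRoot_apply_ne_zero hx w p)
  · intro hw p
    exact (affineRoot_mul_pos hx hw p).not_gt

/-- An affine root $a$ separates $x$ from $wx$ exactly when $a\circ w$ separates $x$ from $w^{-1}x$.
-/
lemma length_inv {x : V} (hx : x ∈ alcove b) (w : affineWeylGroup Φ) :
    length b w⁻¹ = length b w := by
  have h1 := two_mul_length hx w
  have h2 := two_mul_length hx w⁻¹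
  have h3 : separatingRoots Φ x (w.1 x) =
      pullIndex Φ w ⁻¹' separatingRoots Φ x ((w⁻¹).1 x) := by
    ext p
    simp only [separatingRoots, Set.mem_preimage, Set.mem_ofPred_eq, affineRoot_pullIndex,
      coe_apply_inv_apply]
    rw [mul_comm]
  rw [h3, Set.ncard_preimage_of_injective_subset_range (pullIndex_bijective Φ w).1
    (by simp [(pullIndex_bijective Φ w).2.range_eq])] at h1
  omega

lemma length_mul_of_length_eq_zero {x : V} (hx : x ∈ alcove b) (w u : affineWeylGroup Φ)
    (hu : length b u = 0) : length b (w * u) = length b w := by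
  have hu' := (length_eq_zero_iff_mem_alcove hx u).mp hu
  have h1 := two_mul_length hx w
  have h2 := two_mul_length hx (w * u)
  have h3 : separatingRoots Φ x (w.1 x) = separatingRoots Φ x ((w * u).1 x) := by
    ext p
    simp only [separatingRoots, Set.mem_ofPred_eq]
    rw [mul_comm, mul_comm (affineRoot Φ p x)]
    exact mul_neg_iff_of_mul_pos (affineRoot_apply_mul_pos hx hu' w p)
  rw [← h3] at h2
  omega

lemma mem_Omega_iff_length_eq_zero {x : V} (hx : x ∈ alcove b) (u : affineWeylGroup Φ) :
    u ∈ Omega b ↔ length b u = 0 := by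
  constructor
  · intro hu
    have hu : u.1 '' alcove b = alcove b := hu
    rw [length_eq_zero_iff_mem_alcove hx, ← hu]
    exact ⟨x, hx, rfl⟩
  · intro hu
    change u.1 '' alcove b = alcove b
    apply Set.Subset.antisymm
    · rintro _ ⟨y, hy, rfl⟩
      exact (length_eq_zero_iff_mem_alcove hy u).mp hu
    · intro y hy
      refine ⟨(u⁻¹).1 y, ?_, coe_apply_inv_apply Φ u y⟩
      rw [← length_eq_zero_iff_mem_alcove hy, length_inv hy, hu]

end Length

/-! ### Simple reflections, descents and exchange -/

section Walls

variable [Φ.IsCrystallographic]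

lemma simpleReflection_mul_self (j : Option b.support) :
    simpleReflection b i₀ j * simpleReflection b i₀ j = 1 :=
  Subtype.ext (affineReflection_mul_self Φ (wall b i₀ j))

lemma simpleReflection_apply_apply (j : Option b.support) (x : V) :
    (simpleReflection b i₀ j).1 ((simpleReflection b i₀ j).1 x) = x := by
  rw [← coe_mul_apply, simpleReflection_mul_self]
  rfl

lemma affineRoot_wall_simpleReflection (j : Option b.support) (x : V) :
    affineRoot Φ (wall b i₀ j) ((simpleReflection b i₀ j).1 x) =
      -affineRoot Φ (wall b i₀ j) x :=
  affineRoot_affineReflection Φ _ x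

lemma simpleReflection_apply_of_affineRoot_eq_zero {j : Option b.support} {x : V}
    (hx : affineRoot Φ (wall b i₀ j) x = 0) : (simpleReflection b i₀ j).1 x = x := by
  change affineReflection Φ _ _ x = x
  rw [affineReflection_eq, hx, zero_smul, sub_zero]

variable [Finite ι] [Φ.IsReduced] [Φ.IsRootSystem] (hi₀ : IsHighestCoroot b i₀)
include hi₀

/-- Only the wall of a simple reflection separates the alcove from its image. -/
lemma eq_wall_or_of_mem_separatingRoots {j : Option b.support} {x : V} (hx : x ∈ alcove b)
    {p : ι × ℤ} (hp : p ∈ separatingRoots Φ x ((simpleReflection b i₀ j).1 x)) :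
    p = wall b i₀ j ∨ p = negIndex Φ (wall b i₀ j) := by
  by_contra! hc
  obtain ⟨z, hz, hz'⟩ := exists_generic_point_of_wall b hi₀ j
  have pos_case : ∀ p : ι × ℤ, b.IsPos p.1 → p ≠ wall b i₀ j → affineRoot Φ p z ≠ 0 := by
    rintro ⟨i, k⟩ hi hne h0
    have h1 := hz' i hi
    have hik : Φ.coroot' i z = k := sub_eq_zero.mp h0
    rw [hik] at h1
    have hk0 : 0 ≤ k := by exact_mod_cast h1.1.1
    have hk1 : k ≤ 1 := by exact_mod_cast h1.2.1
    obtain rfl | rfl : k = 0 ∨ k = 1 := by omega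
    · exact hne (h1.1.2 (by simp))
    · exact hne (h1.2.2 (by simp))
  have key : ∀ p : ι × ℤ, p ≠ wall b i₀ j → p ≠ negIndex Φ (wall b i₀ j) →
      0 < affineRoot Φ p x * affineRoot Φ p z := by
    intro p h1 h2
    refine (affineRoot_mul_nonneg hx (fun i hi ↦ ⟨(hz' i hi).1.1, (hz' i hi).2.1⟩) p).lt_of_ne'
      (mul_ne_zero (affineRoot_ne_zero hx p) ?_)
    rcases isPos_or_isPos_negIndex b p with h | h
    · exact pos_case p h h1
    · have := pos_case _ h fun h3 ↦ h2 (by rw [← h3, negIndex_negIndex])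
      rwa [affineRoot_negIndex, neg_ne_zero] at this
  have h1 := key p hc.1 hc.2
  -- Since $s_jz=z$, the comparison of signs for $p\circ s_j$ places $s_jx$ on the same side of $p$
  -- as $z$, hence as $x$.
  have h2 := key (pullIndex Φ (simpleReflection b i₀ j) p) (fun h ↦ hc.2 ?_) (fun h ↦ hc.1 ?_)
  · rw [affineRoot_pullIndex, affineRoot_pullIndex,
      simpleReflection_apply_of_affineRoot_eq_zero hz, mul_comm] at h2
    rw [mul_comm] at h1
    have h3 := (mul_neg_iff_of_mul_pos (a := affineRoot Φ p x)
      (a' := affineRoot Φ p z) (by rwa [mul_comm])).mp hp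
    exact absurd h2 h3.not_gt
  all_goals
    refine eq_of_forall_affineRoot_eq Φ fun y ↦ ?_
    have h3 := affineRoot_pullIndex Φ (simpleReflection b i₀ j) p
      ((simpleReflection b i₀ j).1 y)
    rw [simpleReflection_apply_apply, h] at h3
    simp only [← h3, affineRoot_negIndex, affineRoot_wall_simpleReflection, neg_neg]

/-- An affine root other than $\pm a_j$, with $a_j$ the one at the wall, has equal signs at $x$ and
$s_jx$. It therefore separates $x$ from $s_jy$ exactly when its composite with $s_j$ separates $x$
from $y$; only $\pm a_j$ are new. The point $y$ need not lie in an alcove, as the conjugation of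
arbitrary points into the closed alcove requires. -/
lemma ncard_separatingRoots_simpleReflection {j : Option b.support} {x y : V} (hx : x ∈ alcove b)
    (hy : 0 < affineRoot Φ (wall b i₀ j) x * affineRoot Φ (wall b i₀ j) y) :
    (separatingRoots Φ x ((simpleReflection b i₀ j).1 y)).ncard =
      (separatingRoots Φ x y).ncard + 2 := by
  set a := wall b i₀ j with ha
  set s := simpleReflection b i₀ j with hs
  have hane : a ≠ negIndex Φ a := by
    intro h
    have := affineRoot_negIndex Φ a x
    rw [← h] at this
    exact affineRoot_ne_zero hx a (by linarith)
  have hpull : pullIndex Φ s a = negIndex Φ a := eq_of_forall_affineRoot_eq Φ fun z ↦ by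
    rw [affineRoot_pullIndex, affineRoot_wall_simpleReflection, affineRoot_negIndex]
  have hpull' : pullIndex Φ s (negIndex Φ a) = a := eq_of_forall_affineRoot_eq Φ fun z ↦ by
    rw [affineRoot_pullIndex, affineRoot_negIndex, affineRoot_wall_simpleReflection, neg_neg]
  have hna : a ∉ separatingRoots Φ x y := hy.not_gt
  have hna' : negIndex Φ a ∉ separatingRoots Φ x y := by rwa [negIndex_mem_separatingRoots]
  have hmem : a ∈ separatingRoots Φ x (s.1 y) := by
    rw [separatingRoots, Set.mem_ofPred_eq, affineRoot_wall_simpleReflection]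
    linarith
  have hset : separatingRoots Φ x (s.1 y) =
      {a, negIndex Φ a} ∪ pullIndex Φ s ⁻¹' separatingRoots Φ x y := by
    ext p
    by_cases h1 : p = a
    · simp [h1, hmem]
    by_cases h2 : p = negIndex Φ a
    · simp [h2, negIndex_mem_separatingRoots, hmem]
    have h3 : p ∉ separatingRoots Φ x (s.1 x) := fun h ↦
      (eq_wall_or_of_mem_separatingRoots hi₀ hx h).elim h1 h2
    have h4 : 0 < affineRoot Φ p x * affineRoot Φ p (s.1 x) :=
      (not_lt.mp h3).lt_of_ne'
        (mul_ne_zero (affineRoot_ne_zero hx p) (affineRoot_apply_ne_zero hx s p))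
    simp only [Set.mem_union, Set.mem_insert_iff, h1, h2, Set.mem_singleton_iff, false_or,
      Set.mem_preimage, separatingRoots, Set.mem_ofPred_eq, affineRoot_pullIndex]
    exact mul_neg_iff_of_mul_pos h4
  have hdisj : Disjoint {a, negIndex Φ a} (pullIndex Φ s ⁻¹' separatingRoots Φ x y) := by
    rw [Set.disjoint_left]
    rintro p (rfl | rfl) h
    · rw [Set.mem_preimage, hpull] at h
      exact hna' h
    · rw [Set.mem_preimage, hpull'] at h
      exact hna h
  rw [hset, Set.ncard_union_eq hdisj (Set.toFinite _)
    ((finite_separatingRoots Φ x y).preimage (pullIndex_bijective Φ s).1.injOn),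
    Set.ncard_pair hane, Set.ncard_preimage_of_injective_subset_range (pullIndex_bijective Φ s).1
    (by simp [(pullIndex_bijective Φ s).2.range_eq]), add_comm]

lemma length_simpleReflection_mul_of_pos {j : Option b.support} {x : V} (hx : x ∈ alcove b)
    {w : affineWeylGroup Φ}
    (h : 0 < affineRoot Φ (wall b i₀ j) x * affineRoot Φ (wall b i₀ j) (w.1 x)) :
    length b (simpleReflection b i₀ j * w) = length b w + 1 := by
  have h1 := two_mul_length hx (simpleReflection b i₀ j * w)
  rw [coe_mul_apply, ncard_separatingRoots_simpleReflection hi₀ hx h, ← two_mul_length hx] at h1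
  omega

lemma length_simpleReflection_mul_of_neg {j : Option b.support} {x : V} (hx : x ∈ alcove b)
    {w : affineWeylGroup Φ}
    (h : affineRoot Φ (wall b i₀ j) x * affineRoot Φ (wall b i₀ j) (w.1 x) < 0) :
    length b w = length b (simpleReflection b i₀ j * w) + 1 := by
  have := length_simpleReflection_mul_of_pos hi₀ (j := j) hx (w := simpleReflection b i₀ j * w)
    (by rw [coe_mul_apply, affineRoot_wall_simpleReflection]; linarith)
  rwa [← mul_assoc, simpleReflection_mul_self, one_mul] at this

lemma length_simpleReflection_mul_lt_iff {j : Option b.support} {x : V} (hx : x ∈ alcove b)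
    {w : affineWeylGroup Φ} :
    length b (simpleReflection b i₀ j * w) < length b w ↔
      affineRoot Φ (wall b i₀ j) x * affineRoot Φ (wall b i₀ j) (w.1 x) < 0 := by
  rcases (mul_ne_zero (affineRoot_ne_zero hx (wall b i₀ j))
    (affineRoot_apply_ne_zero hx w (wall b i₀ j))).lt_or_gt with h | h
  · have := length_simpleReflection_mul_of_neg hi₀ hx h
    simp only [h, iff_true]
    omega
  · have := length_simpleReflection_mul_of_pos hi₀ hx h
    simp only [h.not_gt, iff_false]
    omega

/-- The closed alcove is cut out by its walls. -/
lemma coroot'_mem_Icc_of_walls {x y : V} (hx : x ∈ alcove b)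
    (hy : ∀ j, 0 ≤ affineRoot Φ (wall b i₀ j) x * affineRoot Φ (wall b i₀ j) y) {i : ι}
    (hi : b.IsPos i) : 0 ≤ Φ.coroot' i y ∧ Φ.coroot' i y ≤ 1 := by
  have h1 : ∀ j ∈ b.support, 0 ≤ Φ.coroot' j y := fun j hj ↦ by
    have h2 := hx j (Base.isPos_of_mem_support hj)
    have h3 := hy (some ⟨j, hj⟩)
    simp only [wall, affineRoot, Int.cast_zero, sub_zero] at h3
    exact nonneg_of_mul_nonneg_right h3 h2.1
  refine ⟨coroot'_nonneg b h1 hi, (coroot'_le_highest hi₀ h1 i).trans ?_⟩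
  have h2 := hx i₀ hi₀.isPos
  have h3 := hy none
  simp only [wall, affineRoot, Int.cast_one] at h3
  nlinarith

/-- Every point is conjugate to a point of the closed alcove. -/
lemma exists_apply_mem_closed_alcove {x : V} (hx : x ∈ alcove b) (y : V) :
    ∃ w : affineWeylGroup Φ, ∀ p, 0 ≤ affineRoot Φ p x * affineRoot Φ p (w.1 y) := by
  induction hn : (separatingRoots Φ x y).ncard using Nat.strong_induction_on generalizing y with
  | _ n ih =>
    subst hn
    by_cases h : ∃ j, affineRoot Φ (wall b i₀ j) x * affineRoot Φ (wall b i₀ j) y < 0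
    · obtain ⟨j, hj⟩ := h
      have h1 := ncard_separatingRoots_simpleReflection hi₀ (j := j) hx
        (y := (simpleReflection b i₀ j).1 y)
        (by rw [affineRoot_wall_simpleReflection]; linarith)
      rw [simpleReflection_apply_apply] at h1
      -- Reflecting in a wall that separates $y$ from the alcove removes two separating affine
      -- roots.
      obtain ⟨w, hw⟩ := ih _ (by omega) ((simpleReflection b i₀ j).1 y) rfl
      exact ⟨w * simpleReflection b i₀ j, hw⟩
    · push Not at h
      exact ⟨1, affineRoot_mul_nonneg hx fun i hi ↦ coroot'_mem_Icc_of_walls hi₀ hx h hi⟩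

/-- The length function of the extended affine Weyl group. -/
theorem isLengthSystem : IsLengthSystem (simpleReflection b i₀) (length b) := by
  obtain ⟨x, hx⟩ := exists_mem_alcove b hi₀
  refine ⟨simpleReflection_mul_self, (length_eq_zero_iff_mem_alcove hx 1).mpr hx, length_inv hx,
    length_mul_of_length_eq_zero hx, fun j w ↦ ?_, fun w hw ↦ ?_, fun j t w h1 h2 ↦ ?_⟩
  · rcases (mul_ne_zero (affineRoot_ne_zero hx (wall b i₀ j))
      (affineRoot_apply_ne_zero hx w (wall b i₀ j))).lt_or_gt with h | h
    · exact Or.inr (length_simpleReflection_mul_of_neg hi₀ hx h)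
    · exact Or.inl (length_simpleReflection_mul_of_pos hi₀ hx h)
  -- Without a left descent no wall separates $A$ from $wx$, so $wx$ lies in the closed alcove;
  -- being on no hyperplane, it lies in $A$.
  · by_contra! hc
    apply hw
    rw [length_eq_zero_iff_mem_alcove hx]
    refine mem_alcove_of_affineRoot_mul_pos hx fun p ↦ (affineRoot_mul_nonneg hx
      (fun i hi ↦ coroot'_mem_Icc_of_walls hi₀ hx (fun j ↦ ?_) hi) p).lt_of_ne'
      (mul_ne_zero (affineRoot_ne_zero hx p) (affineRoot_apply_ne_zero hx w p))
    rw [← not_lt, ← length_simpleReflection_mul_lt_iff hi₀ hx, not_lt]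
    exact hc j
  · rw [length_simpleReflection_mul_lt_iff hi₀ hx] at h1
    have h3 : 0 < affineRoot Φ (wall b i₀ j) x *
        affineRoot Φ (wall b i₀ j) ((w * simpleReflection b i₀ t).1 x) := by
      refine (not_lt.mp ?_).lt_of_ne' (mul_ne_zero (affineRoot_ne_zero hx _)
        (affineRoot_apply_ne_zero hx _ _))
      rw [← length_simpleReflection_mul_lt_iff hi₀ hx, ← mul_assoc]
      exact h2.not_gt
    -- The affine root $a_j\circ w$ separates $x$ from $s_tx$, so it is $\pm a_t$ and its reflection
    -- is $s_t$. Conjugating by $w$ gives $s_jw=ws_t$.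
    have h4 : pullIndex Φ w (wall b i₀ j) ∈
        separatingRoots Φ x ((simpleReflection b i₀ t).1 x) := by
      rw [separatingRoots, Set.mem_ofPred_eq, affineRoot_pullIndex, affineRoot_pullIndex,
        ← coe_mul_apply, mul_comm]
      rw [mul_comm] at h3
      exact (mul_neg_iff_of_mul_pos (by rwa [mul_comm])).mp h1
    have h5 : affineReflection Φ (pullIndex Φ w (wall b i₀ j)).1 (pullIndex Φ w (wall b i₀ j)).2 =
        affineReflection Φ (wall b i₀ t).1 (wall b i₀ t).2 := by
      rcases eq_wall_or_of_mem_separatingRoots hi₀ hx h4 with h | h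
      · rw [h]
      · rw [h, affineReflection_negIndex]
    refine Subtype.ext (AffineEquiv.ext fun y ↦ ?_)
    rw [coe_mul_apply, coe_mul_apply]
    change affineReflection Φ _ _ _ = _
    rw [affineReflection_comp, h5]
    rfl

end Walls

end AffineHecke

/-! ### Transfer from functions on $W$ to functions on $P$ -/

namespace AffineHecke

variable {ι V V' : Type*} [Finite ι] [AddCommGroup V] [Module ℝ V] [AddCommGroup V'] [Module ℝ V']
  {Φ : RootPairing ι ℝ V V'} [Φ.IsCrystallographic] [Φ.IsReduced] {b : Φ.Base}

/-- The function `w ↦ f (w y)` on `W` attached to a function `f` on the weight lattice. -/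
def orbitMap (Φ : RootPairing ι ℝ V V') [Φ.IsCrystallographic] (y : weightLattice Φ) :
    (weightLattice Φ → ℂ) →ₗ[ℂ] (affineWeylGroup Φ → ℂ) where
  toFun f w := f ⟨w.1 y.1, apply_mem_weightLattice Φ w.2 y.2⟩
  map_add' _ _ := rfl
  map_smul' _ _ := rfl

omit [Finite ι] [Φ.IsReduced] in
lemma orbitMap_weylAction (u : affineWeylGroup Φ) (y : weightLattice Φ)
    (f : weightLattice Φ → ℂ) :
    orbitMap Φ y (weylAction Φ u f) = leftTranslate u⁻¹ (orbitMap Φ y f) := rfl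

variable [Φ.IsRootSystem] {i₀ : ι} (hi₀ : IsHighestCoroot b i₀) (q : affineWeylGroup Φ → ℝ)
include hi₀

/-- On orbits of points of the closed alcove the difference-reflection operators come from those
on functions on `W`. -/
lemma orbitMap_diffReflection {x : V} (hx : x ∈ alcove b) {y : weightLattice Φ}
    (hy : ∀ p, 0 ≤ affineRoot Φ p x * affineRoot Φ p y.1) (j : Option b.support)
    (f : weightLattice Φ → ℂ) :
    orbitMap Φ y (diffReflection b i₀ q j f) =
      leftOp (simpleReflection b i₀) (length b) (fun w ↦ (q w : ℂ)) j (orbitMap Φ y f) := by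
  ext w
  rw [leftOp_apply]
  have hinv : (simpleReflection b i₀ j)⁻¹ = simpleReflection b i₀ j :=
    inv_eq_of_mul_eq_one_left (simpleReflection_mul_self j)
  have hP := apply_mem_weightLattice Φ w.2 y.2
  have hL : orbitMap Φ y (diffReflection b i₀ q j f) w =
      q (simpleReflection b i₀ j) * orbitMap Φ y f w + chi b i₀ q j ⟨w.1 y.1, hP⟩ *
        (orbitMap Φ y f ((simpleReflection b i₀ j)⁻¹ * w) - orbitMap Φ y f w) := rfl
  rw [hL, hinv]
  congr 1
  by_cases h0 : affineRoot Φ (wall b i₀ j) (w.1 y.1) = 0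
  · have h1 : orbitMap Φ y f (simpleReflection b i₀ j * w) = orbitMap Φ y f w :=
      congrArg f (Subtype.ext (simpleReflection_apply_of_affineRoot_eq_zero h0))
    rw [h1, sub_self, mul_zero, mul_zero]
  · congr 1
    -- Off $V_j$ the weak inequality at closed alcove points becomes strict: $wx$ and $wy$ lie on
    -- the same side of $V_j$.
    have h1 : 0 < affineRoot Φ (wall b i₀ j) (w.1 x) * affineRoot Φ (wall b i₀ j) (w.1 y.1) := by
      refine lt_of_le_of_ne' ?_ (mul_ne_zero (affineRoot_apply_ne_zero hx w _) h0)
      rw [← affineRoot_pullIndex, ← affineRoot_pullIndex]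
      exact hy _
    have h2 : w.1 y.1 ∉ hyperplane Φ (wall b i₀ j).1 (wall b i₀ j).2 :=
      fun h ↦ h0 (sub_eq_zero.mpr h)
    rw [chi, if_neg h2, regularChi]
    classical
    refine if_congr ?_ rfl rfl
    rw [separates_singleton_alcove_iff hx, length_simpleReflection_mul_lt_iff hi₀ hx, mul_comm,
      mul_comm (affineRoot Φ (wall b i₀ j) x)]
    exact mul_neg_iff_of_mul_pos (by rwa [mul_comm])

/-- A function on the weight lattice is determined by its restrictions to the orbits of the points
of the closed alcove. -/
lemma ext_of_orbitMap {x : V} (hx : x ∈ alcove b) {f g : weightLattice Φ → ℂ}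
    (h : ∀ y : weightLattice Φ, (∀ p, 0 ≤ affineRoot Φ p x * affineRoot Φ p y.1) →
      orbitMap Φ y f = orbitMap Φ y g) : f = g := by
  ext z
  obtain ⟨w, hw⟩ := exists_apply_mem_closed_alcove hi₀ hx z.1
  have h1 := congr_fun (h ⟨w.1 z.1, apply_mem_weightLattice Φ w.2 z.2⟩ hw) w⁻¹
  have h2 : (⟨(w⁻¹).1 (w.1 z.1), apply_mem_weightLattice Φ (w⁻¹).2
      (apply_mem_weightLattice Φ w.2 z.2)⟩ : weightLattice Φ) = z :=
    Subtype.ext (coe_inv_apply_apply Φ w z.1)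
  simpa only [orbitMap, LinearMap.coe_mk, AddHom.coe_mk, h2] using h1

/-- The operators by which the basis elements `T_w` act on functions on the weight lattice. -/
theorem exists_difference_reflection_operators {q : affineWeylGroup Φ → ℝ}
    (hq : IsLengthMultiplicative b q) :
    ∃ X : affineWeylGroup Φ → Module.End ℂ (weightLattice Φ → ℂ),
      (∀ j, X (simpleReflection b i₀ j) = diffReflection b i₀ q j) ∧
      (∀ u, length b u = 0 → X u = weylAction Φ u) ∧
      (∀ v w, length b (v * w) = length b v + length b w → X (v * w) = X v * X w) ∧
      ∀ j f, diffReflection b i₀ q j (diffReflection b i₀ q j f) =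
        ((q (simpleReflection b i₀ j) : ℂ) - (q (simpleReflection b i₀ j) : ℂ)⁻¹) •
          diffReflection b i₀ q j f + f := by
  obtain ⟨x, hx⟩ := exists_mem_alcove b hi₀
  have hℓ := isLengthSystem hi₀
  have hQ : ∀ w, (q w : ℂ) ≠ 0 := fun w ↦ Complex.ofReal_ne_zero.mpr (hq.ne_zero w)
  obtain ⟨T, hTs, hTu, hTmul⟩ := exists_regular_representation hℓ (Q := fun w ↦ (q w : ℂ))
    (fun v w h ↦ by rw [hq.map_mul v w h, Complex.ofReal_mul]) hQ
    (fun u hu ↦ by rw [hq.map_length_zero u hu, Complex.ofReal_one])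
  -- A lift of each $T_w$ is built along some decomposition. Independence of the choice comes from
  -- joint injectivity of the orbit maps, which carries the relations of the $T_w$ over to the
  -- lifts.
  have hex : ∀ w, ∃ X : Module.End ℂ (weightLattice Φ → ℂ), ∀ y : weightLattice Φ,
      (∀ p, 0 ≤ affineRoot Φ p x * affineRoot Φ p y.1) →
      ∀ f, orbitMap Φ y (X f) = T w (orbitMap Φ y f) := by
    intro w
    induction w using hℓ.induction with
    | zero u hu =>
      exact ⟨weylAction Φ u, fun y _ f ↦ by rw [hTu u hu, orbitMap_weylAction]⟩
    | mul j w hw ih =>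
      obtain ⟨X, hX⟩ := ih
      refine ⟨diffReflection b i₀ q j * X, fun y hy f ↦ ?_⟩
      rw [hTmul _ _ (by rw [hw, hℓ.length_simple, add_comm]), Module.End.mul_apply,
        Module.End.mul_apply, orbitMap_diffReflection hi₀ q hx hy, hX y hy, hTs]
  choose X hX using hex
  refine ⟨X, fun j ↦ ?_, fun u hu ↦ ?_, fun v w h ↦ ?_, fun j f ↦ ?_⟩
  · refine LinearMap.ext fun f ↦ ext_of_orbitMap hi₀ hx fun y hy ↦ ?_
    rw [hX _ y hy, orbitMap_diffReflection hi₀ q hx hy, hTs]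
  · refine LinearMap.ext fun f ↦ ext_of_orbitMap hi₀ hx fun y hy ↦ ?_
    rw [hX _ y hy, orbitMap_weylAction, hTu u hu]
  · refine LinearMap.ext fun f ↦ ext_of_orbitMap hi₀ hx fun y hy ↦ ?_
    rw [hX _ y hy, Module.End.mul_apply, hX _ y hy, hX _ y hy, hTmul v w h, Module.End.mul_apply]
  · refine ext_of_orbitMap hi₀ hx fun y hy ↦ ?_
    rw [map_add, map_smul]
    simp only [orbitMap_diffReflection hi₀ q hx hy]
    exact leftOp_leftOp hℓ hQ j _

end AffineHecke

/-! ### The representation and its uniqueness -/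

theorem mainTheorem1 {ι V V' : Type*} [Finite ι] [AddCommGroup V] [Module ℝ V]
    [AddCommGroup V'] [Module ℝ V'] (Φ : RootPairing ι ℝ V V')
    [Φ.IsRootSystem] [Φ.IsCrystallographic] [Φ.IsReduced] [Φ.IsIrreducible] (b : Φ.Base)
    (i₀ : ι) (hi₀ : AffineHecke.IsHighestCoroot b i₀)
    (q : AffineHecke.affineWeylGroup Φ → ℝ) (hq : AffineHecke.IsLengthMultiplicative b q) :
    ∃! ρ : AffineHecke.HeckeAlgebra b i₀ q →ₐ[ℂ]
        Module.End ℂ (AffineHecke.weightLattice Φ → ℂ),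
      (∀ j : Option b.support,
        ρ (AffineHecke.heckeT b i₀ q (AffineHecke.simpleReflection b i₀ j)) =
          AffineHecke.diffReflection b i₀ q j) ∧
      ∀ u ∈ AffineHecke.Omega b,
        ρ (AffineHecke.heckeT b i₀ q u) = AffineHecke.weylAction Φ u := by
  have hℓ := AffineHecke.isLengthSystem hi₀
  obtain ⟨x, hx⟩ := AffineHecke.exists_mem_alcove b hi₀
  obtain ⟨X, hXs, hXu, hXmul, hXX⟩ := AffineHecke.exists_difference_reflection_operators hi₀ hq
  have hrel : ∀ ⦃r t⦄, AffineHecke.HeckeRel b i₀ q r t →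
      FreeAlgebra.lift ℂ X r = FreeAlgebra.lift ℂ X t := by
    rintro r t (_ | j | ⟨v, w, h⟩)
    · rw [FreeAlgebra.lift_ι_apply, map_one, hXu 1 hℓ.one]
      ext1 f
      rfl
    · have hne : (q (AffineHecke.simpleReflection b i₀ j) : ℂ) ≠ 0 :=
        Complex.ofReal_ne_zero.mpr (hq.ne_zero _)
      simp only [map_mul, map_sub, map_add, map_zero, FreeAlgebra.lift_ι_apply, AlgHom.commutes,
        hXs]
      refine LinearMap.ext fun f ↦ ?_
      simp only [Module.End.mul_apply, LinearMap.sub_apply, LinearMap.add_apply, map_add, map_smul,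
        Module.algebraMap_end_apply, hXX, LinearMap.zero_apply]
      rw [smul_sub, smul_smul, inv_mul_cancel₀ hne]
      module
    · rw [map_mul, FreeAlgebra.lift_ι_apply, FreeAlgebra.lift_ι_apply, FreeAlgebra.lift_ι_apply,
        hXmul v w h]
  have hmul : ∀ v w, AffineHecke.length b (v * w) =
      AffineHecke.length b v + AffineHecke.length b w → AffineHecke.heckeT b i₀ q (v * w) =
        AffineHecke.heckeT b i₀ q v * AffineHecke.heckeT b i₀ q w := by
    intro v w h
    simp only [AffineHecke.heckeT, ← map_mul]
    exact RingQuot.mkAlgHom_rel ℂ (AffineHecke.HeckeRel.braid v w h)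
  have hlift : ∀ w, RingQuot.liftAlgHom ℂ ⟨FreeAlgebra.lift ℂ X, hrel⟩
      (AffineHecke.heckeT b i₀ q w) = X w := by
    intro w
    rw [AffineHecke.heckeT, RingQuot.liftAlgHom_mkAlgHom_apply, FreeAlgebra.lift_ι_apply]
  refine ⟨RingQuot.liftAlgHom ℂ ⟨FreeAlgebra.lift ℂ X, hrel⟩, ⟨fun j ↦ ?_, fun u hu ↦ ?_⟩, ?_⟩
  · rw [hlift, hXs]
  · rw [hlift, hXu u ((AffineHecke.mem_Omega_iff_length_eq_zero hx u).mp hu)]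
  · rintro ρ ⟨hρs, hρu⟩
    refine RingQuot.ringQuot_ext' ℂ _ _ (FreeAlgebra.hom_ext (funext fun w ↦ ?_))
    change ρ (AffineHecke.heckeT b i₀ q w) =
      RingQuot.liftAlgHom ℂ ⟨FreeAlgebra.lift ℂ X, hrel⟩ (AffineHecke.heckeT b i₀ q w)
    rw [hlift]
    -- The $T_j$ and the $T_u$ with $u\in\Omega$ generate, since every $T_w$ is a product of them
    -- along a reduced decomposition.
    induction w using hℓ.induction with
    | zero u hu =>
      rw [hρu u ((AffineHecke.mem_Omega_iff_length_eq_zero hx u).mpr hu), hXu u hu]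
    | mul j w hw ih =>
      have h : AffineHecke.length b (AffineHecke.simpleReflection b i₀ j * w) =
          AffineHecke.length b (AffineHecke.simpleReflection b i₀ j) + AffineHecke.length b w := by
        rw [hw, hℓ.length_simple, add_comm]
      rw [hmul _ _ h, map_mul, hρs, ih, hXmul _ _ h, hXs]
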